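/- Proposition 1. Let $\Omega\subset\mathbb R^2$ be a bounded open set with Lipschitz boundary, $g\in L^2(\Omega)$ and $\alpha_1,\alpha_2\ge 0$. There is a constant $c\ge 0$, depending only on $\Omega,g,\alpha_1,\alpha_2$, for which the following holds. Continuous problem. Let $m\in\mathbb N$, let $T:L^2(\Omega)^m\to L^2(\Omega)$ be linear and bounded, $\beta\ge 0$, $\lambda>0$, $r,s\in[1,\infty]$ with $r^{-1}+s^{-1}=1$, and let $S=\mathrm{Id}$ or $S=\nabla$, where $\|S\mathbf v\|_{V_S}$ is the $L^2$-norm of $S\mathbf v$. For $\mathbf v\in H^1(\Omega)^m$ let $$E(\mathbf v)=\alpha_1\|T\mathbf v-g\|_{L^1(\Omega)}+\tfrac{\alpha_2}2\|T\mathbf v-g\|_{L^2(\Omega)}^2+\tfrac\beta2\|S\mathbf v\|_{V_S}^2+\lambda\int_\Omega|\nabla\mathbf v|_{F,r}\,dx,\qquad |w|_{F,r}=\Big(\sum_{n=1}^m\sum_{k=1}^2|w_{nk}|^r\Big)^{1/r}$$ (a maximum if $r=\infty$). For $\mathbf v\in L^2(\Omega)^m\setminus H^1(\Omega)^m$ let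 $E(\mathbf v)\in(-\infty,\infty]$ be given by the same formula, where $\int_\Omega|\nabla\mathbf v|_{F,r}\,dx$ stands for the total variation $\sup\{\int_\Omega\mathbf v\cdot\operatorname{div}\varphi\,dx:\varphi\in C_c^\infty(\Omega;(\mathbb R^2)^m),\ |\varphi|_{F,s}\le 1\}$ and $\|\nabla\mathbf v\|=\infty$ (with $0\cdot\infty=0$). Let $B=\alpha_2T^*T+\beta S^*S$ and $\|\mathbf v\|_B^2=\alpha_2\|T\mathbf v\|^2_{L^2(\Omega)}+\beta\|S\mathbf v\|_{V_S}^2$. Assume that $B$ is invertible, as an operator from $V$ to $V^*$, where $V=L^2(\Omega)^m$ if $S=\mathrm{Id}$ or $\beta=0$, and $V=H^1(\Omega)^m$ if $S=\nabla$ and $\beta>0$. For $\ell\in(H^1(\Omega)^m)^*$ let $\|\ell\|_{B^{-1}}^2=\langle\ell,B^{-1}\ell\rangle$ if $\ell$ extends to an element of $V^*$, and $\|\ell\|_{B^{-1}}^2=\infty$ otherwise. Here $\nabla^*:(L^2(\Omega)^2)^m\to(H^1(\Omega)^m)^*$ is the adjoint of $\nabla$. Let $\mathbf u$ minimize $E$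 over $H^1(\Omega)^m$. Discrete problem. Let $\Omega$ be triangulated by axis-parallel squares $E_1,\dots,E_N$ with side lengths $h_1,\dots,h_N$ (pairwise disjoint open squares in $\Omega$ whose closures cover $\Omega$; in particular any quad-tree grid). Let $I_h$ be the piecewise constant interpolation and $(g_h)_i=h_i^{-2}\int_{E_i}g\,dx$. Discrete functions are multiplied by $\langle v_h,w_h\rangle_{L^2(\Omega_h)}=\sum_ih_i^2(v_h)_i\cdot(w_h)_i$. Let $T_h,\nabla_h,T_h^*,\nabla_h^*,B_h^{-1}$ be any matrices of sizes $N\times mN$, $2mN\times mN$, $mN\times N$, $mN\times 2mN$, $mN\times mN$ (discretizations of $T,\nabla,T^*,\nabla^*,B^{-1}$; no relation between them is assumed), let $S_h=\mathrm{Id}$ if $S=\mathrm{Id}$ and $S_h=\nabla_h$ if $S=\nabla$, and let $\|w_h\|^2_{B_h^{-1}}=\langle w_h,B_h^{-1}w_h\rangle_{L^2(\Omega_h)}$. Let $$E_h(\mathbf v_h)=\alpha_1\sum_ih_i^2|(T_h\mathbf v_h-g_h)_i|+\tfrac{\alpha_2}2\|T_h\mathbf v_h-g_h\|^2_{L^2(\Omega_h)}+\tfrac\beta2\|S_h\mathbf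 v_h\|^2_{L^2(\Omega_h)}+\lambda\sum_ih_i^2|(\nabla_h\mathbf v_h)_i|_{F,r},$$ $$D_h(q_{h,1},\mathbf q_{h,2})=-\tfrac12\|T_h^*q_{h,1}+\nabla_h^*\mathbf q_{h,2}-\alpha_2T_h^*g_h\|^2_{B_h^{-1}}+\tfrac{\alpha_2}2\|g_h\|^2_{L^2(\Omega_h)}-\langle g_h,q_{h,1}\rangle_{L^2(\Omega_h)}$$ if $|(q_{h,1})_i|\le\alpha_1$ and $|(\mathbf q_{h,2})_i|_{F,s}\le\lambda$ for all $i$, and $D_h(q_{h,1},\mathbf q_{h,2})=-\infty$ otherwise. Let $\mathbf u_h$ minimize $E_h$ over $\mathbb R^{mN}$ and let $(p_{h,1},\mathbf p_{h,2})$ maximize $D_h$ over $\mathbb R^N\times\mathbb R^{2mN}$. Then for all $\mathbf v_h\in\mathbb R^{mN}$ and $(q_{h,1},\mathbf q_{h,2})\in\mathbb R^N\times\mathbb R^{2mN}$, $$\tfrac12\|I_h\mathbf u_h-\mathbf u\|_B^2\le\eta_h(\mathbf v_h,q_{h,1},\mathbf q_{h,2})+c\,\|I_hg_h-g\|_{L^2(\Omega)}+R_h(\mathbf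 u_h)+Q_h(p_{h,1},\mathbf p_{h,2})$$ as an inequality in $[-\infty,\infty]$, where $$\eta_h(\mathbf v_h,q_{h,1},\mathbf q_{h,2})=E_h(\mathbf v_h)-D_h(q_{h,1},\mathbf q_{h,2}),\qquad R_h(\mathbf u_h)=E(I_h\mathbf u_h)-E_h(\mathbf u_h),$$ $$Q_h(p_{h,1},\mathbf p_{h,2})=\tfrac12\Big(\|T^*I_hp_{h,1}+\nabla^*I_h\mathbf p_{h,2}-\alpha_2T^*g\|^2_{B^{-1}}-\|T_h^*p_{h,1}+\nabla_h^*\mathbf p_{h,2}-\alpha_2T_h^*g_h\|^2_{B_h^{-1}}\Big).$$ -/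

import Mathlib

open MeasureTheory
open scoped ENNReal ContDiff RealInnerProductSpace

noncomputable section

namespace PDGap

/-! ## Function spaces on a planar domain -/

/-- The plane `ℝ²` with the Euclidean norm. -/
abbrev Pt : Type := EuclideanSpace ℝ (Fin 2)

/-- `ℝᵐ`, the values of an image with `m` channels. -/
abbrev Vec (m : ℕ) : Type := EuclideanSpace ℝ (Fin m)

/-- `(ℝ²)ᵐ`, the values of a gradient; the entry `(n, k)` belongs to channel `n`, direction `k`. -/
abbrev Mat (m : ℕ) : Type := EuclideanSpace ℝ (Fin m × Fin 2)

/-- `L²(Ω; F)` for Lebesgue measure on `Ω`. For `F = ℝ`, `Vec m`, `Mat m` this is `L²(Ω)`,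
`L²(Ω)ᵐ`, `(L²(Ω)²)ᵐ` with the inner product that sums the inner products of the components. -/
abbrev L2 (Ω : Set Pt) (F : Type) [NormedAddCommGroup F] : Type :=
  Lp F 2 (volume.restrict Ω)

/-- Near each boundary point, after a linear isometric change of coordinates, `Ω` is the set of
points above the graph of a Lipschitz function. -/
def HasLipschitzBoundary (Ω : Set Pt) : Prop :=
  ∀ x ∈ frontier Ω, ∃ (Φ : Pt ≃ₗᵢ[ℝ] Pt) (γ : ℝ → ℝ) (K : NNReal) (δ : ℝ),
    0 < δ ∧ LipschitzWith K γ ∧ ∀ y ∈ Metric.ball x δ, (y ∈ Ω ↔ γ (Φ y 0) < Φ y 1)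

/-- Smooth functions on the plane with compact support inside `Ω`. -/
def IsTest {F : Type} [NormedAddCommGroup F] [NormedSpace ℝ F] (Ω : Set Pt) (φ : Pt → F) : Prop :=
  ContDiff ℝ ∞ φ ∧ HasCompactSupport φ ∧ tsupport φ ⊆ Ω

/-- The partial derivative `∂_k φ (x)` of a differentiable function. -/
def pd {F : Type} [NormedAddCommGroup F] [NormedSpace ℝ F] (k : Fin 2) (φ : Pt → F) (x : Pt) : F :=
  fderiv ℝ φ x (EuclideanSpace.single k 1)

/-- `G` is the weak gradient of `v` on `Ω`. -/
def IsWeakGradient (Ω : Set Pt) {m : ℕ} (v : L2 Ω (Vec m)) (G : L2 Ω (Mat m)) : Prop :=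
  ∀ φ : Pt → ℝ, IsTest Ω φ → ∀ (n : Fin m) (k : Fin 2),
    ∫ x in Ω, v x n * pd k φ x = - ∫ x in Ω, G x (n, k) * φ x

theorem integrable_coord_mul {Ω : Set Pt} {ι : Type} [Fintype ι] (f : L2 Ω (EuclideanSpace ℝ ι))
    (i : ι) {ψ : Pt → ℝ} (hc : Continuous ψ) (hs : HasCompactSupport ψ) :
    Integrable (fun x => f x i * ψ x) (volume.restrict Ω) := by
  have h1 : MemLp (fun x => f x i) 2 (volume.restrict Ω) :=
    (EuclideanSpace.proj i : EuclideanSpace ℝ ι →L[ℝ] ℝ).comp_memLp' (Lp.memLp f)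
  have h2 : MemLp ψ 2 (volume.restrict Ω) := hc.memLp_of_hasCompactSupport hs
  exact h1.integrable_mul h2

theorem IsTest.continuous_pd {Ω : Set Pt} {φ : Pt → ℝ} (h : IsTest Ω φ) (k : Fin 2) :
    Continuous (pd k φ) :=
  (h.1.continuous_fderiv (by simp)).clm_apply continuous_const

theorem IsTest.hasCompactSupport_pd {Ω : Set Pt} {φ : Pt → ℝ} (h : IsTest Ω φ) (k : Fin 2) :
    HasCompactSupport (pd k φ) :=
  h.2.1.fderiv_apply ℝ _

/-- The Sobolev space `H¹(Ω)ᵐ`, as the Hilbert space of all pairs `(v, ∇v)` with `v ∈ L²(Ω)ᵐ` whose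
weak gradient is in `(L²(Ω)²)ᵐ`; its norm is `(‖v‖² + ‖∇v‖²)^(1/2)`. -/
def H1 (Ω : Set Pt) (m : ℕ) : Submodule ℝ (WithLp 2 (L2 Ω (Vec m) × L2 Ω (Mat m))) where
  carrier := {w | IsWeakGradient Ω w.fst w.snd}
  zero_mem' := by
    intro φ _ n k
    have e1 : ∀ᵐ x ∂(volume.restrict Ω), (0 : L2 Ω (Vec m)) x n * pd k φ x = 0 := by
      filter_upwards [Lp.coeFn_zero (Vec m) 2 (volume.restrict Ω)] with x hx
      rw [hx]; simp
    have e2 : ∀ᵐ x ∂(volume.restrict Ω), (0 : L2 Ω (Mat m)) x (n, k) * φ x = 0 := by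
      filter_upwards [Lp.coeFn_zero (Mat m) 2 (volume.restrict Ω)] with x hx
      rw [hx]; simp
    change ∫ x in Ω, (0 : L2 Ω (Vec m)) x n * pd k φ x
      = - ∫ x in Ω, (0 : L2 Ω (Mat m)) x (n, k) * φ x
    rw [integral_congr_ae e1, integral_congr_ae e2]
    simp
  add_mem' := by
    intro a b ha hb φ hφ n k
    have e1 : ∀ᵐ x ∂(volume.restrict Ω), (a.fst + b.fst : L2 Ω (Vec m)) x n * pd k φ x
        = a.fst x n * pd k φ x + b.fst x n * pd k φ x := by
      filter_upwards [Lp.coeFn_add a.fst b.fst] with x hx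
      rw [hx]; simp only [Pi.add_apply, PiLp.add_apply, add_mul]
    have e2 : ∀ᵐ x ∂(volume.restrict Ω), (a.snd + b.snd : L2 Ω (Mat m)) x (n, k) * φ x
        = a.snd x (n, k) * φ x + b.snd x (n, k) * φ x := by
      filter_upwards [Lp.coeFn_add a.snd b.snd] with x hx
      rw [hx]; simp only [Pi.add_apply, PiLp.add_apply, add_mul]
    change ∫ x in Ω, (a.fst + b.fst : L2 Ω (Vec m)) x n * pd k φ x
      = - ∫ x in Ω, (a.snd + b.snd : L2 Ω (Mat m)) x (n, k) * φ x
    have hp := hφ.continuous_pd k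
    have hps := hφ.hasCompactSupport_pd k
    rw [integral_congr_ae e1, integral_congr_ae e2,
      integral_add (integrable_coord_mul _ n hp hps) (integrable_coord_mul _ n hp hps),
      integral_add (integrable_coord_mul _ (n, k) hφ.1.continuous hφ.2.1)
        (integrable_coord_mul _ (n, k) hφ.1.continuous hφ.2.1), ha φ hφ n k, hb φ hφ n k]
    ring
  smul_mem' := by
    intro c a ha φ hφ n k
    have e1 : ∀ᵐ x ∂(volume.restrict Ω), (c • a.fst : L2 Ω (Vec m)) x n * pd k φ x
        = c * (a.fst x n * pd k φ x) := by
      filter_upwards [Lp.coeFn_smul c a.fst] with x hx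
      rw [hx]; simp only [Pi.smul_apply, PiLp.smul_apply, smul_eq_mul, mul_assoc]
    have e2 : ∀ᵐ x ∂(volume.restrict Ω), (c • a.snd : L2 Ω (Mat m)) x (n, k) * φ x
        = c * (a.snd x (n, k) * φ x) := by
      filter_upwards [Lp.coeFn_smul c a.snd] with x hx
      rw [hx]; simp only [Pi.smul_apply, PiLp.smul_apply, smul_eq_mul, mul_assoc]
    change ∫ x in Ω, (c • a.fst : L2 Ω (Vec m)) x n * pd k φ x
      = - ∫ x in Ω, (c • a.snd : L2 Ω (Mat m)) x (n, k) * φ x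
    rw [integral_congr_ae e1, integral_congr_ae e2, integral_const_mul, integral_const_mul,
      ha φ hφ n k]
    ring

/-- The embedding `H¹(Ω)ᵐ → L²(Ω)ᵐ`. -/
def incl (Ω : Set Pt) (m : ℕ) : H1 Ω m →L[ℝ] L2 Ω (Vec m) :=
  (WithLp.fstL 2 ℝ (L2 Ω (Vec m)) (L2 Ω (Mat m))) ∘L (H1 Ω m).subtypeL

/-- The gradient `∇ : H¹(Ω)ᵐ → (L²(Ω)²)ᵐ`. -/
def grad (Ω : Set Pt) (m : ℕ) : H1 Ω m →L[ℝ] L2 Ω (Mat m) :=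
  (WithLp.sndL 2 ℝ (L2 Ω (Vec m)) (L2 Ω (Mat m))) ∘L (H1 Ω m).subtypeL

/-- The Frobenius norm `|w|_{F,p} = (∑ |w_{nk}|ᵖ)^(1/p)`; the maximum of the `|w_{nk}|` if
`p = ∞`. -/
def frob {m : ℕ} (p : ℝ≥0∞) (w : Mat m) : ℝ :=
  ‖(WithLp.toLp p (fun j => w j) : PiLp p (fun _ : Fin m × Fin 2 => ℝ))‖

/-- The total variation `∫_Ω |Dv|_{F,r}` in `[0, ∞]`, where `s` is the exponent conjugate to `r`, so
that `|·|_{F,s}` is the norm dual to `|·|_{F,r}`. -/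
def totalVariation {Ω : Set Pt} {m : ℕ} (s : ℝ≥0∞) (v : L2 Ω (Vec m)) : ℝ≥0∞ :=
  ⨆ (φ : Pt → Mat m) (_ : IsTest Ω φ ∧ ∀ x, frob s (φ x) ≤ 1),
    ENNReal.ofReal (∫ x in Ω, ∑ n, v x n * ∑ k, pd k φ x (n, k))

/-! ## The continuous problem -/

/-- The two choices `S = Id` and `S = ∇`. -/
inductive Reg : Type
  | id
  | grad

/-- `‖S w‖²_{V_S}` for `w ∈ H¹(Ω)ᵐ`. -/
def sNormSq {Ω : Set Pt} {m : ℕ} : Reg → H1 Ω m → ℝ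
  | .id, w => ‖incl Ω m w‖ ^ 2
  | .grad, w => ‖grad Ω m w‖ ^ 2

/-- The energy `E` of the primal problem on `H¹(Ω)ᵐ`. -/
def primalEnergy {Ω : Set Pt} {m : ℕ} (g : L2 Ω ℝ) (α₁ α₂ β lam : ℝ) (r : ℝ≥0∞)
    (T : L2 Ω (Vec m) →L[ℝ] L2 Ω ℝ) (S : Reg) (w : H1 Ω m) : ℝ :=
  α₁ * (∫ x in Ω, |(T (incl Ω m w) - g : L2 Ω ℝ) x|) + α₂ / 2 * ‖T (incl Ω m w) - g‖ ^ 2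
    + β / 2 * sNormSq S w + lam * ∫ x in Ω, frob r (grad Ω m w x)

/-- `u` solves the primal problem. -/
def IsPrimalSolution {Ω : Set Pt} {m : ℕ} (g : L2 Ω ℝ) (α₁ α₂ β lam : ℝ) (r : ℝ≥0∞)
    (T : L2 Ω (Vec m) →L[ℝ] L2 Ω ℝ) (S : Reg) (u : H1 Ω m) : Prop :=
  ∀ w : H1 Ω m,
    primalEnergy g α₁ α₂ β lam r T S u ≤ primalEnergy g α₁ α₂ β lam r T S w

open Classical in
/-- `‖S v‖²_{V_S}` for `v ∈ L²(Ω)ᵐ`; for `S = ∇` it is `∞` off `H¹(Ω)ᵐ`. -/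
def sNormSqExt {Ω : Set Pt} {m : ℕ} : Reg → L2 Ω (Vec m) → ℝ≥0∞
  | .id, v => ENNReal.ofReal (‖v‖ ^ 2)
  | .grad, v => if h : ∃ w : H1 Ω m, incl Ω m w = v then
      ENNReal.ofReal (‖grad Ω m h.choose‖ ^ 2) else ⊤

open Classical in
/-- The energy `E` on `L²(Ω)ᵐ`: the one of the primal problem on `H¹(Ω)ᵐ`; off `H¹(Ω)ᵐ` (as for most
piecewise constant functions) the integral of `|∇v|_{F,r}` is the total variation of `v`.
The element of `H¹(Ω)ᵐ` that is chosen is unique, since weak gradients are. In `[0, ∞]`,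
`0 * ∞ = 0`. -/
def extEnergy {Ω : Set Pt} {m : ℕ} (g : L2 Ω ℝ) (α₁ α₂ β lam : ℝ) (r s : ℝ≥0∞)
    (T : L2 Ω (Vec m) →L[ℝ] L2 Ω ℝ) (S : Reg) (v : L2 Ω (Vec m)) : EReal :=
  if h : ∃ w : H1 Ω m, incl Ω m w = v then
    ((primalEnergy g α₁ α₂ β lam r T S h.choose : ℝ) : EReal)
  else
    ((α₁ * (∫ x in Ω, |(T v - g : L2 Ω ℝ) x|) + α₂ / 2 * ‖T v - g‖ ^ 2 : ℝ) : EReal)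
      + ((ENNReal.ofReal (β / 2) * sNormSqExt S v
        + ENNReal.ofReal lam * totalVariation s v : ℝ≥0∞) : EReal)

/-- `‖v‖²_B = α₂ ‖T v‖² + β ‖S v‖²`. -/
def bNormSq {Ω : Set Pt} {m : ℕ} (α₂ β : ℝ) (T : L2 Ω (Vec m) →L[ℝ] L2 Ω ℝ) (S : Reg)
    (v : L2 Ω (Vec m)) : EReal :=
  ((α₂ * ‖T v‖ ^ 2 : ℝ) : EReal) + ((ENNReal.ofReal β * sNormSqExt S v : ℝ≥0∞) : EReal)

/-- The operator `α₂ A* A + β Σ* Σ : V → V*`. -/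
def normalOp {Ω : Set Pt} {V W : Type} [NormedAddCommGroup V] [InnerProductSpace ℝ V]
    [NormedAddCommGroup W] [InnerProductSpace ℝ W] (α₂ β : ℝ)
    (A : V →L[ℝ] L2 Ω ℝ) (Sg : V →L[ℝ] W) : V →L[ℝ] StrongDual ℝ V :=
  α₂ • (innerSL ℝ).bilinearComp A A + β • (innerSL ℝ).bilinearComp Sg Sg

/-- `B = α₂ T* T + β S* S` as an operator from `L²(Ω)ᵐ` to its dual, for `S = Id` or `β = 0`. -/
def opL2 {Ω : Set Pt} {m : ℕ} (α₂ β : ℝ) (T : L2 Ω (Vec m) →L[ℝ] L2 Ω ℝ) :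
    L2 Ω (Vec m) →L[ℝ] StrongDual ℝ (L2 Ω (Vec m)) :=
  normalOp α₂ β T (ContinuousLinearMap.id ℝ (L2 Ω (Vec m)))

/-- `B = α₂ T* T + β S* S` as an operator from `H¹(Ω)ᵐ` to its dual, for `S = ∇` and `β ≠ 0`. -/
def opH1 {Ω : Set Pt} {m : ℕ} (α₂ β : ℝ) (T : L2 Ω (Vec m) →L[ℝ] L2 Ω ℝ) :
    H1 Ω m →L[ℝ] StrongDual ℝ (H1 Ω m) :=
  normalOp α₂ β (T ∘L incl Ω m) (grad Ω m)

open Classical in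
/-- `B` is invertible, on `L²(Ω)ᵐ` if it is an operator of order zero and on `H¹(Ω)ᵐ` if it has the
part `β ∇* ∇`. -/
def BInvertible {Ω : Set Pt} {m : ℕ} (α₂ β : ℝ) (T : L2 Ω (Vec m) →L[ℝ] L2 Ω ℝ) (S : Reg) :
    Prop :=
  if S = .id ∨ β = 0 then (opL2 α₂ β T).IsInvertible else (opH1 α₂ β T).IsInvertible

/-- `⟨ℓ, B⁻¹ ℓ⟩` for a functional `ℓ` on `H¹(Ω)ᵐ` and `B : V → V*`, where `j` embeds `H¹(Ω)ᵐ` densely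
in `V`: if `ℓ` extends to a (then unique) element `f` of `V*`, the value is `⟨f, B⁻¹ f⟩`, else
`∞`. -/
def invSq {Ω : Set Pt} {m : ℕ} {V : Type} [NormedAddCommGroup V] [InnerProductSpace ℝ V]
    (B : V →L[ℝ] StrongDual ℝ V) (j : H1 Ω m →L[ℝ] V) (ℓ : StrongDual ℝ (H1 Ω m)) : EReal :=
  ⨅ (f : StrongDual ℝ V) (_ : f ∘L j = ℓ), ((f (B.inverse f) : ℝ) : EReal)

open Classical in
/-- `‖ℓ‖²_{B⁻¹} = ⟨ℓ, B⁻¹ ℓ⟩`. -/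
def bInvNormSq {Ω : Set Pt} {m : ℕ} (α₂ β : ℝ) (T : L2 Ω (Vec m) →L[ℝ] L2 Ω ℝ) (S : Reg)
    (ℓ : StrongDual ℝ (H1 Ω m)) : EReal :=
  if S = .id ∨ β = 0 then invSq (opL2 α₂ β T) (incl Ω m) ℓ
  else invSq (opH1 α₂ β T) (ContinuousLinearMap.id ℝ (H1 Ω m)) ℓ

/-- An element of `L²(Ω)ᵐ` as a functional on `H¹(Ω)ᵐ`. -/
def toDual {Ω : Set Pt} {m : ℕ} (f : L2 Ω (Vec m)) : StrongDual ℝ (H1 Ω m) :=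
  (innerSL ℝ f) ∘L incl Ω m

/-- The adjoint `∇*` of the gradient, with values in the dual of `H¹(Ω)ᵐ`. -/
def gradAdj {Ω : Set Pt} {m : ℕ} (q : L2 Ω (Mat m)) : StrongDual ℝ (H1 Ω m) :=
  (innerSL ℝ q) ∘L grad Ω m

/-- `T* p₁ + ∇* p₂ - α₂ T* g`. -/
def dualResidual {Ω : Set Pt} {m : ℕ} (g : L2 Ω ℝ) (α₂ : ℝ) (T : L2 Ω (Vec m) →L[ℝ] L2 Ω ℝ)
    (p₁ : L2 Ω ℝ) (p₂ : L2 Ω (Mat m)) : StrongDual ℝ (H1 Ω m) :=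
  toDual (ContinuousLinearMap.adjoint T p₁) + gradAdj p₂
    - α₂ • toDual (ContinuousLinearMap.adjoint T g)

/-! ## Grids of squares and the discrete problem -/

/-- The open axis-parallel square with center `x` and side length `h`. -/
def square (x : Pt) (h : ℝ) : Set Pt := {y | ∀ k, |y k - x k| < h / 2}

theorem isOpen_square (x : Pt) (h : ℝ) : IsOpen (square x h) := by
  have : square x h = ⋂ k, {y : Pt | |y k - x k| < h / 2} := by
    ext y; simp [square]
  rw [this]
  exact isOpen_iInter_of_finite fun k => isOpen_lt (by fun_prop) continuous_const

theorem isBounded_square (x : Pt) (h : ℝ) : Bornology.IsBounded (square x h) := by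
  refine (Metric.isBounded_closedBall (x := x) (r := Real.sqrt (∑ _k : Fin 2, (h / 2) ^ 2))).subset ?_
  intro y hy
  rw [Metric.mem_closedBall, EuclideanSpace.dist_eq]
  refine Real.sqrt_le_sqrt (Finset.sum_le_sum fun k _ => ?_)
  have hk := hy k
  rw [Real.dist_eq]
  gcongr

theorem volume_square_ne_top (Ω : Set Pt) (x : Pt) (h : ℝ) :
    volume.restrict Ω (square x h) ≠ ⊤ :=
  ((Measure.restrict_apply_le _ _).trans_lt (isBounded_square x h).measure_lt_top).ne

/-- A triangulation of `Ω` by `N` axis-parallel squares, of arbitrary sizes. -/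
structure SquareGrid (Ω : Set Pt) (N : ℕ) where
  center : Fin N → Pt
  side : Fin N → ℝ
  side_pos : ∀ i, 0 < side i
  subset : ∀ i, square (center i) (side i) ⊆ Ω
  disjoint : ∀ i j, i ≠ j → Disjoint (square (center i) (side i)) (square (center j) (side j))
  cover : Ω ⊆ ⋃ i, closure (square (center i) (side i))

/-- The `i`-th element of the grid. -/
def SquareGrid.cell {Ω : Set Pt} {N : ℕ} (G : SquareGrid Ω N) (i : Fin N) : Set Pt :=
  square (G.center i) (G.side i)

/-- The piecewise constant interpolation `I_h`. -/
def SquareGrid.interp {Ω : Set Pt} {N : ℕ} (G : SquareGrid Ω N) {F : Type} [NormedAddCommGroup F]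
    (v : Fin N → F) : L2 Ω F :=
  ∑ i, indicatorConstLp 2 (isOpen_square (G.center i) (G.side i)).measurableSet
    (volume_square_ne_top Ω (G.center i) (G.side i)) (v i)

/-- The discretization `g_h` of `g` by mean values over the elements. -/
def SquareGrid.discretize {Ω : Set Pt} {N : ℕ} (G : SquareGrid Ω N) (g : L2 Ω ℝ) : Fin N → ℝ :=
  fun i => (G.side i ^ 2)⁻¹ * ∫ x in G.cell i, g x

/-- The scalar products of `L²(Ω_h)`, `L²(Ω_h)ᵐ` and `(L²(Ω_h)²)ᵐ`. -/
def SquareGrid.inner {Ω : Set Pt} {N : ℕ} (G : SquareGrid Ω N) {F : Type} [NormedAddCommGroup F]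
    [InnerProductSpace ℝ F] (v w : Fin N → F) : ℝ :=
  ∑ i, G.side i ^ 2 * ⟪v i, w i⟫

/-- `‖S_h v_h‖²_{V_{S,h}}`, where `S_h = Id` if `S = Id` and `S_h = ∇_h` if `S = ∇`. -/
def sNormSqDisc {Ω : Set Pt} {N m : ℕ} (G : SquareGrid Ω N)
    (gradh : (Fin N → Vec m) →ₗ[ℝ] (Fin N → Mat m)) : Reg → (Fin N → Vec m) → ℝ
  | .id, v => G.inner v v
  | .grad, v => G.inner (gradh v) (gradh v)

/-- The discrete primal energy `E_h`. -/
def discEnergy {Ω : Set Pt} {N m : ℕ} (G : SquareGrid Ω N) (g : L2 Ω ℝ) (α₁ α₂ β lam : ℝ)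
    (r : ℝ≥0∞) (S : Reg) (Th : (Fin N → Vec m) →ₗ[ℝ] (Fin N → ℝ))
    (gradh : (Fin N → Vec m) →ₗ[ℝ] (Fin N → Mat m)) (v : Fin N → Vec m) : ℝ :=
  α₁ * ∑ i, G.side i ^ 2 * |(Th v - G.discretize g) i|
    + α₂ / 2 * G.inner (Th v - G.discretize g) (Th v - G.discretize g)
    + β / 2 * sNormSqDisc G gradh S v
    + lam * ∑ i, G.side i ^ 2 * frob r (gradh v i)

/-- `‖T_h* q₁ + ∇_h* q₂ - α₂ T_h* g_h‖²_{B_h⁻¹}`, where `‖w‖²_{B_h⁻¹} = ⟨w, B_h⁻¹ w⟩`. -/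
def discResidualSq {Ω : Set Pt} {N m : ℕ} (G : SquareGrid Ω N) (g : L2 Ω ℝ) (α₂ : ℝ)
    (Ths : (Fin N → ℝ) →ₗ[ℝ] (Fin N → Vec m))
    (gradhs : (Fin N → Mat m) →ₗ[ℝ] (Fin N → Vec m))
    (Bhi : (Fin N → Vec m) →ₗ[ℝ] (Fin N → Vec m))
    (q₁ : Fin N → ℝ) (q₂ : Fin N → Mat m) : ℝ :=
  G.inner (Ths q₁ + gradhs q₂ - α₂ • Ths (G.discretize g))
    (Bhi (Ths q₁ + gradhs q₂ - α₂ • Ths (G.discretize g)))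

open Classical in
/-- The discrete dual energy `D_h`, equal to `-∞` unless `|q₁| ≤ α₁` and `|q₂|_{F,s} ≤ λ` on all
elements. -/
def discDual {Ω : Set Pt} {N m : ℕ} (G : SquareGrid Ω N) (g : L2 Ω ℝ) (α₁ α₂ lam : ℝ)
    (s : ℝ≥0∞) (Ths : (Fin N → ℝ) →ₗ[ℝ] (Fin N → Vec m))
    (gradhs : (Fin N → Mat m) →ₗ[ℝ] (Fin N → Vec m))
    (Bhi : (Fin N → Vec m) →ₗ[ℝ] (Fin N → Vec m))
    (q₁ : Fin N → ℝ) (q₂ : Fin N → Mat m) : EReal :=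
  if (∀ i, |q₁ i| ≤ α₁) ∧ (∀ i, frob s (q₂ i) ≤ lam) then
    ((-(1 / 2) * discResidualSq G g α₂ Ths gradhs Bhi q₁ q₂
      + α₂ / 2 * G.inner (G.discretize g) (G.discretize g)
      - G.inner (G.discretize g) q₁ : ℝ) : EReal)
  else ⊥

/-- The discrete primal-dual gap `η_h`. -/
def gapError {Ω : Set Pt} {N m : ℕ} (G : SquareGrid Ω N) (g : L2 Ω ℝ) (α₁ α₂ β lam : ℝ)
    (r s : ℝ≥0∞) (S : Reg) (Th : (Fin N → Vec m) →ₗ[ℝ] (Fin N → ℝ))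
    (Ths : (Fin N → ℝ) →ₗ[ℝ] (Fin N → Vec m))
    (gradh : (Fin N → Vec m) →ₗ[ℝ] (Fin N → Mat m))
    (gradhs : (Fin N → Mat m) →ₗ[ℝ] (Fin N → Vec m))
    (Bhi : (Fin N → Vec m) →ₗ[ℝ] (Fin N → Vec m))
    (v : Fin N → Vec m) (q₁ : Fin N → ℝ) (q₂ : Fin N → Mat m) : EReal :=
  ((discEnergy G g α₁ α₂ β lam r S Th gradh v : ℝ) : EReal)
    - discDual G g α₁ α₂ lam s Ths gradhs Bhi q₁ q₂

/-- The primal consistency term `R_h`. -/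
def primalConsistency {Ω : Set Pt} {N m : ℕ} (G : SquareGrid Ω N) (g : L2 Ω ℝ)
    (α₁ α₂ β lam : ℝ) (r s : ℝ≥0∞) (T : L2 Ω (Vec m) →L[ℝ] L2 Ω ℝ) (S : Reg)
    (Th : (Fin N → Vec m) →ₗ[ℝ] (Fin N → ℝ))
    (gradh : (Fin N → Vec m) →ₗ[ℝ] (Fin N → Mat m)) (v : Fin N → Vec m) : EReal :=
  extEnergy g α₁ α₂ β lam r s T S (G.interp v)
    - ((discEnergy G g α₁ α₂ β lam r S Th gradh v : ℝ) : EReal)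

/-- The dual consistency term `Q_h`. -/
def dualConsistency {Ω : Set Pt} {N m : ℕ} (G : SquareGrid Ω N) (g : L2 Ω ℝ) (α₂ β : ℝ)
    (T : L2 Ω (Vec m) →L[ℝ] L2 Ω ℝ) (S : Reg)
    (Ths : (Fin N → ℝ) →ₗ[ℝ] (Fin N → Vec m))
    (gradhs : (Fin N → Mat m) →ₗ[ℝ] (Fin N → Vec m))
    (Bhi : (Fin N → Vec m) →ₗ[ℝ] (Fin N → Vec m))
    (p₁ : Fin N → ℝ) (p₂ : Fin N → Mat m) : EReal :=
  ((1 / 2 : ℝ) : EReal) *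
    (bInvNormSq α₂ β T S (dualResidual g α₂ T (G.interp p₁) (G.interp p₂))
      - ((discResidualSq G g α₂ Ths gradhs Bhi p₁ p₂ : ℝ) : EReal))

end PDGap

end

open PDGap

/-!
The primal energy is convex, with the quadratic part `½‖·‖²_B`, so a minimizer `u` satisfies
`½‖w - u‖²_B ≤ E(w) - E(u)` for every `w` in `H¹`. This extends to every `w` in `L²` of finite total
variation: cut `w` up with a smooth partition of unity, translate each piece into the Lipschitz
domain, and mollify. The result is smooth, close to `w` in `L²`, and its total variation exceeds
that of `w` by at most a commutator which tends to `0` in `L¹`. For `w = I_h u_h` the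
right-hand side is `R_h(u_h) + E_h(u_h) - E(u)`.

Weak duality at the feasible point `I_h p_h` bounds `-E(u)` by the dual norm of the residual of
`I_h p_h` and terms in `g`; comparing these with `D_h(p_h)` leaves `Q_h(p_h)`. Since
`⟪g, I_h p_{h,1}⟫ = ⟪g_h, p_{h,1}⟫` and `‖g_h‖ ≤ ‖g‖`, replacing `g` by `g_h` contributes only a
term of favorable sign, so the estimate holds with `c = 0`.
-/

noncomputable section

namespace PDGap

/-! ## The norms `frob p` and their duality -/

section Frob

variable {m : ℕ} {p r s : ℝ≥0∞}

/-- The identity map of `ℝ^{m × 2}`, with the `p`-norm on the target; it transfers the norm laws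
to `frob p`. -/
def frobMap (m : ℕ) (p : ℝ≥0∞) [Fact (1 ≤ p)] :
    Mat m →L[ℝ] PiLp p (fun _ : Fin m × Fin 2 => ℝ) :=
  LinearMap.toContinuousLinearMap
    ((WithLp.linearEquiv 2 ℝ (Fin m × Fin 2 → ℝ)).trans
      (WithLp.linearEquiv p ℝ (Fin m × Fin 2 → ℝ)).symm).toLinearMap

theorem frob_eq_norm [Fact (1 ≤ p)] (w : Mat m) : frob p w = ‖frobMap m p w‖ := rfl

theorem frob_nonneg [Fact (1 ≤ p)] (w : Mat m) : 0 ≤ frob p w := norm_nonneg _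

theorem frob_zero [Fact (1 ≤ p)] : frob p (0 : Mat m) = 0 := by
  rw [frob_eq_norm, map_zero, norm_zero]

theorem frob_add_le [Fact (1 ≤ p)] (v w : Mat m) : frob p (v + w) ≤ frob p v + frob p w := by
  simp only [frob_eq_norm, map_add]
  exact norm_add_le _ _

theorem frob_neg [Fact (1 ≤ p)] (w : Mat m) : frob p (-w) = frob p w := by
  simp only [frob_eq_norm, map_neg, norm_neg]

theorem continuous_frob [Fact (1 ≤ p)] : Continuous (frob p : Mat m → ℝ) :=
  (frobMap m p).continuous.norm

theorem abs_apply_le_frob [Fact (1 ≤ p)] (w : Mat m) (j : Fin m × Fin 2) : |w j| ≤ frob p w :=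
  PiLp.norm_apply_le (p := p) (frobMap m p w) j

theorem norm_le_mul_frob [Fact (1 ≤ p)] (w : Mat m) :
    ‖w‖ ≤ √(Fintype.card (Fin m × Fin 2)) * frob p w := by
  rw [EuclideanSpace.norm_eq]
  refine (Real.sqrt_le_sqrt (Finset.sum_le_card_nsmul _ _ (frob p w ^ 2) fun j _ => ?_)).trans_eq ?_
  · exact pow_le_pow_left₀ (norm_nonneg _) (abs_apply_le_frob w j) 2
  · rw [nsmul_eq_mul, Real.sqrt_mul (Nat.cast_nonneg _), Real.sqrt_sq (frob_nonneg w),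
      Finset.card_univ]

theorem convexOn_frob [Fact (1 ≤ p)] : ConvexOn ℝ Set.univ (frob p : Mat m → ℝ) :=
  convexOn_univ_norm.comp_linearMap (frobMap m p).toLinearMap

theorem convex_frob_le [Fact (1 ≤ p)] (c : ℝ) : Convex ℝ {w : Mat m | frob p w ≤ c} := by
  simpa using convexOn_frob.convex_le c

theorem frob_one (w : Mat m) : frob 1 w = ∑ j, |w j| := by
  rw [frob, PiLp.norm_eq_sum (by simp)]
  simp

theorem frob_top (w : Mat m) : frob ⊤ w = ⨆ j, |w j| := by
  simp [frob, PiLp.norm_eq_ciSup]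

theorem frob_toReal (hp : 0 < p.toReal) (w : Mat m) :
    frob p w = (∑ j, |w j| ^ p.toReal) ^ (1 / p.toReal) := by
  simp [frob, PiLp.norm_eq_sum hp]

theorem inner_eq_sum {ι : Type*} [Fintype ι] (a b : EuclideanSpace ℝ ι) :
    ⟪a, b⟫ = ∑ j, a j * b j := by
  simp [PiLp.inner_apply, mul_comm]

theorem inner_le_frob_one_mul_frob_top (a b : Mat m) : ⟪a, b⟫ ≤ frob 1 a * frob ⊤ b := by
  rw [inner_eq_sum, frob_one, Finset.sum_mul]
  refine Finset.sum_le_sum fun j _ => (le_abs_self _).trans ?_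
  rw [abs_mul]
  exact mul_le_mul_of_nonneg_left (abs_apply_le_frob b j) (abs_nonneg _)

theorem abs_sign_le_one (x : ℝ) : |(SignType.sign x : ℝ)| ≤ 1 := by
  rcases lt_trichotomy x 0 with hx | rfl | hx
  · simp [sign_neg hx]
  · simp
  · simp [sign_pos hx]

theorem exists_frob_top_le_one_inner_eq (a : Mat m) :
    ∃ b : Mat m, frob ⊤ b ≤ 1 ∧ ⟪a, b⟫ = frob 1 a := by
  refine ⟨WithLp.toLp 2 fun j => (SignType.sign (a j) : ℝ), ?_, ?_⟩
  · rw [frob_top]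
    exact Real.iSup_le (fun j => abs_sign_le_one _) zero_le_one
  · simp only [inner_eq_sum, frob_one, self_mul_sign]

theorem exists_frob_one_le_one_inner_eq (a : Mat m) :
    ∃ b : Mat m, frob 1 b ≤ 1 ∧ ⟪a, b⟫ = frob ⊤ a := by
  rcases isEmpty_or_nonempty (Fin m × Fin 2) with he | hne
  · exact ⟨0, by simp [frob_one], by simp [frob_top]⟩
  · obtain ⟨j, hj⟩ := exists_eq_ciSup_of_finite (f := fun j => |a j|)
    refine ⟨EuclideanSpace.single j (SignType.sign (a j) : ℝ), ?_, ?_⟩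
    · rw [frob_one, Fintype.sum_eq_single j fun i hi => by simp [hi]]
      simpa using abs_sign_le_one (a j)
    · rw [frob_top, ← hj, inner_eq_sum, Fintype.sum_eq_single j fun i hi => by simp [hi]]
      simp

theorem exists_frob_le_one_inner_eq_of_toReal (h : r.toReal.HolderConjugate s.toReal)
    (a : Mat m) : ∃ b : Mat m, frob s b ≤ 1 ∧ ⟪a, b⟫ = frob r a := by
  obtain ⟨c, hc, hc'⟩ := (NNReal.isGreatest_Lp Finset.univ (fun j => Real.nnabs (a j)) h).1
  refine ⟨WithLp.toLp 2 fun j => (SignType.sign (a j) : ℝ) * c j, ?_, ?_⟩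
  · rw [frob_toReal h.symm.pos]
    refine Real.rpow_le_one (by positivity) ?_ h.symm.one_div_nonneg
    calc ∑ j, |(SignType.sign (a j) : ℝ) * c j| ^ s.toReal
        ≤ ∑ j, (c j : ℝ) ^ s.toReal := by
          gcongr with j
          rw [abs_mul, NNReal.abs_eq]
          exact mul_le_of_le_one_left (c j).2 (abs_sign_le_one _)
      _ ≤ 1 := mod_cast hc
  · have hsum := congrArg ((↑) : NNReal → ℝ) hc'
    push_cast at hsum
    simp only [inner_eq_sum, ← mul_assoc, self_mul_sign, frob_toReal h.pos]
    exact hsum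

theorem holderConjugate_cases [H : r.HolderConjugate s] :
    (r = 1 ∧ s = ⊤) ∨ (r = ⊤ ∧ s = 1) ∨ r.toReal.HolderConjugate s.toReal := by
  by_cases hr : r = ⊤
  · exact .inr (.inl ⟨hr, by simpa [hr] using H.inv_add_inv_eq_inv⟩)
  by_cases hs : s = ⊤
  · exact .inl ⟨by simpa [hs] using H.inv_add_inv_eq_inv, hs⟩
  · exact .inr (.inr (ENNReal.HolderConjugate.toReal_of_ne_top hr hs))

theorem inner_le_frob_mul_frob [r.HolderConjugate s] (a b : Mat m) :
    ⟪a, b⟫ ≤ frob r a * frob s b := by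
  rcases holderConjugate_cases (r := r) (s := s) with ⟨rfl, rfl⟩ | ⟨rfl, rfl⟩ | h
  · exact inner_le_frob_one_mul_frob_top a b
  · rw [real_inner_comm, mul_comm]
    exact inner_le_frob_one_mul_frob_top b a
  · rw [inner_eq_sum, frob_toReal h.pos, frob_toReal h.symm.pos]
    exact Real.inner_le_Lp_mul_Lq _ _ _ h

theorem inner_le_frob_of_frob_le_one [r.HolderConjugate s] (a : Mat m) {b : Mat m}
    (hb : frob s b ≤ 1) : ⟪a, b⟫ ≤ frob r a :=
  have : Fact (1 ≤ r) := ⟨ENNReal.HolderConjugate.one_le r s⟩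
  (inner_le_frob_mul_frob a b).trans (mul_le_of_le_one_right (frob_nonneg a) hb)

theorem exists_frob_le_one_inner_eq [r.HolderConjugate s] (a : Mat m) :
    ∃ b : Mat m, frob s b ≤ 1 ∧ ⟪a, b⟫ = frob r a := by
  rcases holderConjugate_cases (r := r) (s := s) with ⟨rfl, rfl⟩ | ⟨rfl, rfl⟩ | h
  · exact exists_frob_top_le_one_inner_eq a
  · exact exists_frob_one_le_one_inner_eq a
  · exact exists_frob_le_one_inner_eq_of_toReal h a

theorem exists_measurable_frob_le_one [r.HolderConjugate s] {δ : ℝ} (hδ : 0 < δ) :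
    ∃ d : Mat m → Mat m, Measurable d ∧ (∀ a, frob s (d a) ≤ 1) ∧
      ∀ a, frob r a ≤ ⟪a, d a⟫ + δ := by
  classical
  have : Fact (1 ≤ r) := ⟨ENNReal.HolderConjugate.one_le r s⟩
  choose b hb hbr using fun a : Mat m => exists_frob_le_one_inner_eq (r := r) (s := s) a
  let e := TopologicalSpace.denseSeq (Mat m)
  have hclose : ∀ a, ∃ k, frob r (a - e k) < δ / 2 := fun a => by
    have hopen : IsOpen {c | frob r (a - c) < δ / 2} :=
      isOpen_lt (continuous_frob.comp (continuous_const.sub continuous_id)) continuous_const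
    obtain ⟨-, hk, k, rfl⟩ := (TopologicalSpace.denseRange_denseSeq (Mat m)).inter_open_nonempty _
      hopen ⟨a, by simpa [frob_zero] using half_pos hδ⟩
    exact ⟨k, hk⟩
  refine ⟨fun a => b (e (Nat.find (hclose a))), ?_, fun a => hb _, fun a => ?_⟩
  · refine (measurable_from_nat (f := fun k => b (e k))).comp (measurable_find hclose fun k => ?_)
    exact measurableSet_lt (continuous_frob.measurable.comp (measurable_id.sub_const _))
      measurable_const
  · set c := e (Nat.find (hclose a))
    have hac : frob r (a - c) < δ / 2 := Nat.find_spec (hclose a)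
    have hsplit : frob r a ≤ frob r (a - c) + frob r c := by
      simpa using frob_add_le (p := r) (a - c) c
    have hcb : frob r c = ⟪a, b c⟫ + ⟪c - a, b c⟫ := by
      rw [← inner_add_left, add_sub_cancel, hbr]
    have hca : ⟪c - a, b c⟫ ≤ frob r (a - c) := by
      rw [← frob_neg, neg_sub]
      exact inner_le_frob_of_frob_le_one _ (hb c)
    linarith

end Frob

/-! ## Mollification -/

section Mollifier

open Filter Topology
open scoped Convolution

theorem exists_contDiffBump_rOut_eq {V : Type*} (x : V) {ε : ℝ} (hε : 0 < ε) :
    ∃ ρ : ContDiffBump x, ρ.rOut = ε :=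
  ⟨⟨ε / 2, ε, half_pos hε, half_lt_self hε⟩, rfl⟩

variable {V E : Type*} [NormedAddCommGroup V] [InnerProductSpace ℝ V] [FiniteDimensional ℝ V]
  [MeasurableSpace V] [BorelSpace V] [NormedAddCommGroup E]

/-- The probability measure whose density is the normalized bump function `ρ`. -/
def bumpMeasure (ρ : ContDiffBump (0 : V)) : Measure V :=
  volume.withDensity fun t => ENNReal.ofReal (ρ.normed volume t)

theorem measurable_ofReal_normed (ρ : ContDiffBump (0 : V)) :
    Measurable fun t => ENNReal.ofReal (ρ.normed volume t) :=
  ENNReal.measurable_ofReal.comp ρ.continuous_normed.measurable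

instance (ρ : ContDiffBump (0 : V)) : IsProbabilityMeasure (bumpMeasure ρ) := by
  constructor
  rw [bumpMeasure, withDensity_apply _ MeasurableSet.univ, Measure.restrict_univ,
    ← ofReal_integral_eq_lintegral_ofReal ρ.integrable_normed
      (Eventually.of_forall ρ.nonneg_normed), ρ.integral_normed, ENNReal.ofReal_one]

theorem ae_bumpMeasure_norm_lt (ρ : ContDiffBump (0 : V)) :
    ∀ᵐ t ∂(bumpMeasure ρ), ‖t‖ < ρ.rOut := by
  rw [bumpMeasure, ae_withDensity_iff (measurable_ofReal_normed ρ)]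
  refine Eventually.of_forall fun t ht => ?_
  have hmem : t ∈ Function.support (ρ.normed volume) := fun h0 => by simp [h0] at ht
  simpa [ρ.support_normed_eq] using hmem

variable [NormedSpace ℝ E]

theorem integral_bumpMeasure (ρ : ContDiffBump (0 : V)) (f : V → E) :
    ∫ t, f t ∂(bumpMeasure ρ) = ∫ t, ρ.normed volume t • f t := by
  rw [bumpMeasure, integral_withDensity_eq_integral_toReal_smul (measurable_ofReal_normed ρ)
    (Eventually.of_forall fun _ => ENNReal.ofReal_lt_top)]
  simp only [ENNReal.toReal_ofReal (ρ.nonneg_normed _)]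

theorem integral_bumpMeasure_neg (ρ : ContDiffBump (0 : V)) (f : V → E) :
    ∫ t, f (-t) ∂(bumpMeasure ρ) = ∫ t, f t ∂(bumpMeasure ρ) := by
  rw [integral_bumpMeasure, integral_bumpMeasure, ← integral_neg_eq_self]
  simp only [neg_neg, ρ.normed_neg]

/-- The mollification of `F` by the bump function `ρ`, evaluated at `x + a` instead of `x`. -/
def moll (ρ : ContDiffBump (0 : V)) (a : V) (F : V → E) (x : V) : E :=
  ∫ t, F (x + a - t) ∂(bumpMeasure ρ)

variable (ρ : ContDiffBump (0 : V)) (a : V)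

theorem moll_eq_convolution (F : V → E) :
    moll ρ a F =
      (ρ.normed volume ⋆[ContinuousLinearMap.lsmul ℝ ℝ, volume] F) ∘ fun x => x + a := by
  ext x
  rw [moll, integral_bumpMeasure]
  rfl

theorem integrable_comp_sub_bumpMeasure {F : V → E} (hF : LocallyIntegrable F) (y : V) :
    Integrable (fun t => F (y - t)) (bumpMeasure ρ) := by
  rw [bumpMeasure, integrable_withDensity_iff_integrable_smul' (measurable_ofReal_normed ρ)
    (Eventually.of_forall fun _ => ENNReal.ofReal_lt_top)]
  simp only [ENNReal.toReal_ofReal (ρ.nonneg_normed _)]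
  exact (ρ.hasCompactSupport_normed (μ := volume)).convolutionExists_left
    (ContinuousLinearMap.lsmul ℝ ℝ) ρ.continuous_normed hF y

theorem contDiff_moll {F : V → E} (hF : LocallyIntegrable F) :
    ContDiff ℝ ∞ (moll ρ a F) := by
  rw [moll_eq_convolution]
  exact (ρ.hasCompactSupport_normed.contDiff_convolution_left _ ρ.contDiff_normed hF).comp
    (contDiff_id.add contDiff_const)

theorem fderiv_moll {φ : V → E} (hφ : ContDiff ℝ 1 φ) (hc : HasCompactSupport φ)
    (x : V) : fderiv ℝ (moll ρ a φ) x = moll ρ a (fderiv ℝ φ) x := by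
  have hloc : LocallyIntegrable (fderiv ℝ φ) :=
    (hφ.continuous_fderiv one_ne_zero).locallyIntegrable
  have hderiv := (hc.hasFDerivAt_convolution_right (μ := volume) (ContinuousLinearMap.lsmul ℝ ℝ)
    (ρ.integrable_normed (μ := volume)).locallyIntegrable hφ (x + a)).comp x
      ((hasFDerivAt_id x).add_const a)
  ext v
  rw [moll_eq_convolution, show (fun x => x + a) = fun x => id x + a from rfl, hderiv.fderiv, moll,
    ContinuousLinearMap.integral_apply (integrable_comp_sub_bumpMeasure ρ hloc (x + a)),
    integral_bumpMeasure, ContinuousLinearMap.comp_id]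
  exact convolution_precompR_apply _ (ρ.integrable_normed (μ := volume)).locallyIntegrable
    (hc.fderiv ℝ) (hφ.continuous_fderiv one_ne_zero) _ _

theorem moll_mem_of_forall_mem [CompleteSpace E] {K : Set E} (hconv : Convex ℝ K)
    (hK : IsClosed K) {F : V → E} (hF : LocallyIntegrable F) (hFK : ∀ x, F x ∈ K) (x : V) :
    moll ρ a F x ∈ K :=
  hconv.integral_mem hK (Eventually.of_forall fun _ => hFK _)
    (integrable_comp_sub_bumpMeasure ρ hF _)

theorem exists_of_moll_ne_zero {F : V → E} {x : V} (h : moll ρ a F x ≠ 0) :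
    ∃ t : V, ‖t‖ < ρ.rOut ∧ F (x + a - t) ≠ 0 := by
  by_contra! H
  refine h (integral_eq_zero_of_ae ?_)
  filter_upwards [ae_bumpMeasure_norm_lt ρ] with t ht using H t ht

open Pointwise in
theorem support_moll_subset (F : V → E) :
    Function.support (moll ρ a F) ⊆ Function.support F + Metric.closedBall (-a) ρ.rOut := by
  intro x hx
  obtain ⟨t, ht, hxt⟩ := exists_of_moll_ne_zero ρ a hx
  refine Set.mem_add.2 ⟨x + a - t, hxt, t - a, ?_, by abel⟩
  simpa [dist_eq_norm] using ht.le

theorem clm_moll [CompleteSpace E] {E' : Type*} [NormedAddCommGroup E'] [NormedSpace ℝ E']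
    [CompleteSpace E'] (L : E →L[ℝ] E') {F : V → E} (hF : LocallyIntegrable F) (x : V) :
    L (moll ρ a F x) = moll ρ a (fun y => L (F y)) x :=
  (L.integral_comp_comm (integrable_comp_sub_bumpMeasure ρ hF (x + a))).symm

end Mollifier

section MollifierAdjoint

open Filter

variable {V E : Type*} [NormedAddCommGroup V] [InnerProductSpace ℝ V] [FiniteDimensional ℝ V]
  [MeasurableSpace V] [BorelSpace V] [NormedAddCommGroup E] [InnerProductSpace ℝ E]

theorem integrable_inner_of_norm_le {α : Type*} [MeasurableSpace α] {μ : Measure α} {f g : α → E}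
    {C : ℝ} (hf : Integrable f μ) (hg : AEStronglyMeasurable g μ) (hC : ∀ x, ‖g x‖ ≤ C) :
    Integrable (fun x => ⟪f x, g x⟫) μ := by
  refine (hf.norm.mul_const C).mono' (hf.1.inner hg) (Eventually.of_forall fun x => ?_)
  exact (norm_inner_le_norm _ _).trans (mul_le_mul_of_nonneg_left (hC x) (norm_nonneg _))

theorem integral_inner_moll [CompleteSpace E] (ρ : ContDiffBump (0 : V)) (a : V) {F φ : V → E}
    (hF : Integrable F) (hφ : Continuous φ) {C : ℝ} (hC : ∀ x, ‖φ x‖ ≤ C) :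
    ∫ x, ⟪moll ρ a F x, φ x⟫ = ∫ y, ⟪F y, moll ρ (-a) φ y⟫ := by
  have hFshift : Integrable (fun z : V × V => F (z.2 + a - z.1)) ((bumpMeasure ρ).prod volume) := by
    have h := (measurePreserving_prod_neg_add (bumpMeasure ρ)
      (volume : Measure V)).integrable_comp_of_integrable
        ((hF.comp_add_right a).comp_snd (bumpMeasure ρ))
    refine h.congr (Eventually.of_forall fun z => ?_)
    simp only [Function.comp_apply]
    congr 1
    abel
  calc ∫ x, ⟪moll ρ a F x, φ x⟫
      = ∫ x, ∫ t, ⟪F (x + a - t), φ x⟫ ∂(bumpMeasure ρ) := by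
        refine integral_congr_ae (Eventually.of_forall fun x => ?_)
        simp only [moll, real_inner_comm (φ x)]
        exact (integral_inner (integrable_comp_sub_bumpMeasure ρ hF.locallyIntegrable _) _).symm
    _ = ∫ t, ∫ x, ⟪F (x + a - t), φ x⟫ ∂(volume) ∂(bumpMeasure ρ) :=
        (integral_integral_swap (f := fun t x => ⟪F (x + a - t), φ x⟫)
          (integrable_inner_of_norm_le hFshift
            (hφ.comp continuous_snd).aestronglyMeasurable fun z => hC _)).symm
    _ = ∫ t, ∫ y, ⟪F y, φ (y - a + t)⟫ ∂(volume) ∂(bumpMeasure ρ) := by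
        refine integral_congr_ae (Eventually.of_forall fun t => ?_)
        dsimp only
        rw [← integral_add_right_eq_self _ (t - a)]
        simp [add_sub, sub_add_eq_add_sub]
    _ = ∫ y, ∫ t, ⟪F y, φ (y - a + t)⟫ ∂(bumpMeasure ρ) :=
        integral_integral_swap (integrable_inner_of_norm_le (hF.comp_snd (bumpMeasure ρ))
          (hφ.comp (by fun_prop)).aestronglyMeasurable fun z => hC _)
    _ = ∫ y, ⟪F y, moll ρ (-a) φ y⟫ := by
        refine integral_congr_ae (Eventually.of_forall fun y => ?_)
        dsimp only [moll]
        rw [← integral_inner (integrable_comp_sub_bumpMeasure ρ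
          (hφ.locallyIntegrable (μ := volume)) _), ← integral_bumpMeasure_neg]
        simp only [sub_eq_add_neg]

end MollifierAdjoint

section MollifierConvergence

open Filter Topology

theorem exists_forall_add_norm_smul_lt {V ι : Type*} [NormedAddCommGroup V]
    [NormedSpace ℝ V] [Finite ι] (a : ι → V) {η : ι → ℝ}
    (hη : ∀ i, 0 < η i) : ∃ ε₀ > 0, ∀ ε : ℝ, 0 < ε → ε < ε₀ → ∀ i, ε + ‖ε • a i‖ < η i := by
  have hsmall : ∀ᶠ ε : ℝ in 𝓝 0, ∀ i, ε + ‖ε • a i‖ < η i := by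
    refine eventually_all.2 fun i => ?_
    have hcont : Continuous fun ε : ℝ => ε + ‖ε • a i‖ := by fun_prop
    exact (hcont.tendsto' 0 0 (by simp)).eventually_lt_const (hη i)
  obtain ⟨ε₀, hε₀, hlt⟩ := Metric.eventually_nhds_iff.1 hsmall
  exact ⟨ε₀, hε₀, fun ε hε hlt₀ => hlt (by rwa [Real.dist_0_eq_abs, abs_of_pos hε])⟩

variable {V E : Type*} [NormedAddCommGroup V] [InnerProductSpace ℝ V] [FiniteDimensional ℝ V]
  [MeasurableSpace V] [BorelSpace V] [NormedAddCommGroup E] {p : ℝ≥0∞} [Fact (1 ≤ p)]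

theorem exists_eLpNorm_translate_sub_le (hp : p ≠ ⊤) {F : V → E} (hF : MemLp F p) {δ : ℝ≥0∞}
    (hδ : 0 < δ) : ∃ η > 0, ∀ y : V, ‖y‖ < η → eLpNorm (fun x => F (x + y) - F x) p ≤ δ := by
  have : Fact (p ≠ ⊤) := ⟨hp⟩
  have hcont : Continuous fun y : V => DomAddAct.mk y +ᵥ hF.toLp F :=
    DomAddAct.continuous_mk.vadd continuous_const
  obtain ⟨η, hη, H⟩ := Metric.eventually_nhds_iff.1
    ((hcont.tendsto 0).eventually (Metric.closedEBall_mem_nhds _ hδ))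
  refine ⟨η, hη, fun y hy => ?_⟩
  have hdist := H (y := y) (by simpa using hy)
  rw [DomAddAct.mk_vadd_toLp, DomAddAct.mk_vadd_toLp, Lp.edist_toLp_toLp] at hdist
  simpa [Pi.sub_def, add_comm] using hdist

theorem eLpNorm_rpow_toReal {α : Type*} [MeasurableSpace α] {μ : Measure α} (hp : p ≠ ⊤)
    (f : α → E) : eLpNorm f p μ ^ p.toReal = ∫⁻ x, ‖f x‖ₑ ^ p.toReal ∂μ := by
  have hp0 : p ≠ 0 := (one_pos.trans_le Fact.out).ne'
  rw [eLpNorm_eq_lintegral_rpow_enorm_toReal hp0 hp, one_div,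
    ENNReal.rpow_inv_rpow (ENNReal.toReal_ne_zero.2 ⟨hp0, hp⟩)]

variable [NormedSpace ℝ E] [CompleteSpace E]

theorem enorm_moll_sub_rpow_le (hp : p ≠ ⊤) (ρ : ContDiffBump (0 : V)) (a : V) {F : V → E}
    (hm : StronglyMeasurable F) (hF : LocallyIntegrable F) (x : V) :
    ‖moll ρ a F x - F x‖ₑ ^ p.toReal
      ≤ ∫⁻ t, ‖F (x + a - t) - F x‖ₑ ^ p.toReal ∂(bumpMeasure ρ) := by
  have hmoll : moll ρ a F x - F x = ∫ t, (F (x + a - t) - F x) ∂(bumpMeasure ρ) := by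
    rw [integral_sub (integrable_comp_sub_bumpMeasure ρ hF (x + a)) (integrable_const _)]
    simp [moll]
  rw [hmoll, ← eLpNorm_rpow_toReal hp]
  gcongr
  calc ‖∫ t, (F (x + a - t) - F x) ∂(bumpMeasure ρ)‖ₑ
      ≤ eLpNorm (fun t => F (x + a - t) - F x) 1 (bumpMeasure ρ) := by
        rw [eLpNorm_one_eq_lintegral_enorm]
        exact enorm_integral_le_lintegral_enorm _
    _ ≤ eLpNorm (fun t => F (x + a - t) - F x) p (bumpMeasure ρ) :=
        eLpNorm_le_eLpNorm_of_exponent_le Fact.out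
          ((hm.comp_measurable (measurable_const.sub measurable_id)).sub
            stronglyMeasurable_const).aestronglyMeasurable

theorem exists_eLpNorm_moll_sub_le (hp : p ≠ ⊤) {F : V → E} (hm : StronglyMeasurable F)
    (hF : MemLp F p) {δ : ℝ≥0∞} (hδ : 0 < δ) :
    ∃ η > 0, ∀ (ρ : ContDiffBump (0 : V)) (a : V), ρ.rOut + ‖a‖ < η →
      eLpNorm (fun x => moll ρ a F x - F x) p ≤ δ := by
  obtain ⟨η, hη, H⟩ := exists_eLpNorm_translate_sub_le hp hF hδ
  refine ⟨η, hη, fun ρ a hρ => ?_⟩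
  have hp' : 0 < p.toReal := ENNReal.toReal_pos (one_pos.trans_le Fact.out).ne' hp
  rw [← ENNReal.rpow_le_rpow_iff hp', eLpNorm_rpow_toReal hp]
  calc ∫⁻ x, ‖moll ρ a F x - F x‖ₑ ^ p.toReal
      ≤ ∫⁻ x, ∫⁻ t, ‖F (x + a - t) - F x‖ₑ ^ p.toReal ∂(bumpMeasure ρ) :=
        lintegral_mono fun x =>
          enorm_moll_sub_rpow_le hp ρ a hm (hF.locallyIntegrable Fact.out) x
    _ = ∫⁻ t, (∫⁻ x, ‖F (x + a - t) - F x‖ₑ ^ p.toReal) ∂(bumpMeasure ρ) := by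
        refine lintegral_lintegral_swap (Measurable.aemeasurable ?_)
        exact ((hm.comp_measurable ((measurable_fst.add_const a).sub measurable_snd)).sub
          (hm.comp_measurable measurable_fst)).enorm.pow_const _
    _ ≤ ∫⁻ _t, δ ^ p.toReal ∂(bumpMeasure ρ) := by
        refine lintegral_mono_ae ?_
        filter_upwards [ae_bumpMeasure_norm_lt ρ] with t ht
        rw [← eLpNorm_rpow_toReal hp]
        gcongr
        simpa only [add_sub_assoc] using H (a - t) ((norm_sub_le a t).trans_lt (by linarith))
    _ = δ ^ p.toReal := by simp

theorem exists_eLpNorm_sum_moll_sub_le (hp : p ≠ ⊤) {ι : Type*} [Fintype ι] (a : ι → V)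
    {F : ι → V → E} (hm : ∀ i, StronglyMeasurable (F i)) (hF : ∀ i, MemLp (F i) p) {δ : ℝ≥0∞}
    (hδ : 0 < δ) :
    ∃ η > 0, ∀ ρ : ContDiffBump (0 : V), ρ.rOut < η →
      eLpNorm (∑ i, fun x => moll ρ (ρ.rOut • a i) (F i) x - F i x) p ≤ δ := by
  have hδι : 0 < δ / Fintype.card ι := ENNReal.div_pos hδ.ne' (ENNReal.natCast_ne_top _)
  choose η hη H using fun i => exists_eLpNorm_moll_sub_le hp (hm i) (hF i) hδι
  obtain ⟨ε, hε, hlt⟩ := exists_forall_add_norm_smul_lt a hη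
  refine ⟨ε, hε, fun ρ hρ => ?_⟩
  have hmeas : ∀ i, AEStronglyMeasurable
      (fun x => moll ρ (ρ.rOut • a i) (F i) x - F i x) volume := fun i =>
    (contDiff_moll ρ _ ((hF i).locallyIntegrable Fact.out)).continuous.aestronglyMeasurable.sub
      (hm i).aestronglyMeasurable
  have hsum : ∑ i, eLpNorm (fun x => moll ρ (ρ.rOut • a i) (F i) x - F i x) p volume
      ≤ ∑ _i : ι, δ / Fintype.card ι :=
    Finset.sum_le_sum fun i _ => H i ρ _ (hlt ρ.rOut ρ.rOut_pos hρ i)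
  refine (eLpNorm_sum_le (fun i _ => hmeas i) Fact.out).trans (hsum.trans ?_)
  rw [Finset.sum_const, nsmul_eq_mul, Finset.card_univ]
  exact ENNReal.mul_div_le

end MollifierConvergence

/-! ## Integrals determined by test fields -/

section Duality

open Filter Topology

theorem le_of_eventually_le_add_mul {x M C : ℝ} (h : ∀ᶠ δ in 𝓝[>] (0 : ℝ), x ≤ M + δ * C) :
    x ≤ M := by
  have hlim : Tendsto (fun δ : ℝ => M + δ * C) (𝓝[>] 0) (𝓝 M) :=
    tendsto_nhdsWithin_of_tendsto_nhds (Continuous.tendsto' (by fun_prop) _ _ (by simp))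
  exact ge_of_tendsto hlim h

section Hilbert

variable {α E : Type*} [MeasurableSpace α] {μ : Measure α} [NormedAddCommGroup E]
  [InnerProductSpace ℝ E]

theorem integral_inner_coeFn_eq_inner_toLp (G : Lp E 2 μ) {f : α → E} (hf : MemLp f 2 μ) :
    ∫ x, ⟪G x, f x⟫ ∂μ = ⟪G, hf.toLp f⟫ := by
  rw [L2.inner_def]
  refine integral_congr_ae ?_
  filter_upwards [hf.coeFn_toLp] with x hx
  rw [hx]

theorem integrable_inner_coeFn (G : Lp E 2 μ) {f : α → E} (hf : MemLp f 2 μ) :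
    Integrable (fun x => ⟪G x, f x⟫) μ := by
  refine (L2.integrable_inner (𝕜 := ℝ) G (hf.toLp f)).congr ?_
  filter_upwards [hf.coeFn_toLp] with x hx
  rw [hx]

theorem integral_inner_coeFn_sub (G : Lp E 2 μ) {f g : α → E} (hf : MemLp f 2 μ)
    (hg : MemLp g 2 μ) :
    ∫ x, ⟪G x, f x - g x⟫ ∂μ = ∫ x, ⟪G x, f x⟫ ∂μ - ∫ x, ⟪G x, g x⟫ ∂μ := by
  simp only [inner_sub_right]
  exact integral_sub (integrable_inner_coeFn G hf) (integrable_inner_coeFn G hg)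

theorem abs_integral_inner_coeFn_le (G : Lp E 2 μ) {f : α → E} (hf : MemLp f 2 μ) {δ : ℝ}
    (hδ : 0 ≤ δ) (h : eLpNorm f 2 μ ≤ ENNReal.ofReal δ) :
    |∫ x, ⟪G x, f x⟫ ∂μ| ≤ δ * ‖G‖ := by
  rw [integral_inner_coeFn_eq_inner_toLp G hf, mul_comm]
  refine (abs_real_inner_le_norm _ _).trans ?_
  gcongr
  rw [Lp.norm_toLp]
  exact ENNReal.toReal_le_of_le_ofReal hδ h

end Hilbert

variable {Ω : Set Pt} {m : ℕ} {r s : ℝ≥0∞}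

section Field

variable {E : Type} [NormedAddCommGroup E]

theorem IsTest.memLp [NormedSpace ℝ E] {φ : Pt → E} (hφ : IsTest Ω φ) (p : ℝ≥0∞)
    (μ : Measure Pt) [IsFiniteMeasureOnCompacts μ] : MemLp φ p μ :=
  hφ.1.continuous.memLp_of_hasCompactSupport hφ.2.1

open Pointwise in
theorem exists_isTest_eLpNorm_sub_le [NormedSpace ℝ E] [CompleteSpace E] (hΩ : IsOpen Ω)
    {K : Set Pt} (hK : IsCompact K) (hKΩ : K ⊆ Ω) {p : ℝ≥0∞} [Fact (1 ≤ p)] (hp : p ≠ ⊤)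
    {Φ : Pt → E} (hm : StronglyMeasurable Φ) (hΦ : MemLp Φ p) (hsupp : Function.support Φ ⊆ K)
    {C : Set E} (hconv : Convex ℝ C) (hC : IsClosed C) (hΦC : ∀ x, Φ x ∈ C) {δ : ℝ≥0∞}
    (hδ : 0 < δ) :
    ∃ φ, IsTest Ω φ ∧ (∀ x, φ x ∈ C) ∧ eLpNorm (fun x => φ x - Φ x) p ≤ δ := by
  have hloc : LocallyIntegrable Φ := hΦ.locallyIntegrable Fact.out
  obtain ⟨ε₁, hε₁, hthick⟩ := hK.exists_cthickening_subset_open hΩ hKΩ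
  obtain ⟨ε₂, hε₂, hclose⟩ := exists_eLpNorm_moll_sub_le hp hm hΦ hδ
  obtain ⟨ε, hε, hε₁₂⟩ := exists_between (lt_min hε₁ hε₂)
  obtain ⟨ρ, hρ⟩ := exists_contDiffBump_rOut_eq (0 : Pt) hε
  have hcompact : IsCompact (K + Metric.closedBall 0 ε) := hK.add (isCompact_closedBall _ _)
  have htsupp : tsupport (moll ρ 0 Φ) ⊆ K + Metric.closedBall 0 ε := by
    refine closure_minimal ((support_moll_subset ρ 0 Φ).trans ?_) hcompact.isClosed
    rw [neg_zero, hρ]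
    exact Set.add_subset_add_right hsupp
  refine ⟨moll ρ 0 Φ, ⟨contDiff_moll ρ 0 hloc,
    hcompact.of_isClosed_subset (isClosed_tsupport _) htsupp, htsupp.trans ?_⟩,
    moll_mem_of_forall_mem ρ 0 hconv hC hloc hΦC, hclose ρ 0 ?_⟩
  · rw [hK.add_closedBall_zero hε.le]
    exact (Metric.cthickening_mono (hε₁₂.le.trans (min_le_left _ _)) K).trans hthick
  · simpa [hρ] using hε₁₂.trans_le (min_le_right _ _)

theorem integral_inner_le_of_forall_isTest [InnerProductSpace ℝ E] [CompleteSpace E]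
    (hΩ : IsOpen Ω) (G : L2 Ω E) {C : Set E} (hconv : Convex ℝ C) (hC : IsClosed C) {M : ℝ}
    (H : ∀ φ, IsTest Ω φ → (∀ x, φ x ∈ C) → ∫ x in Ω, ⟪G x, φ x⟫ ≤ M) {K : Set Pt}
    (hK : IsCompact K) (hKΩ : K ⊆ Ω) {Φ : Pt → E} (hm : StronglyMeasurable Φ) (hΦ : MemLp Φ 2)
    (hsupp : Function.support Φ ⊆ K) (hΦC : ∀ x, Φ x ∈ C) :
    ∫ x in Ω, ⟪G x, Φ x⟫ ≤ M := by
  refine le_of_eventually_le_add_mul (C := ‖G‖) ?_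
  filter_upwards [self_mem_nhdsWithin] with δ hδ
  obtain ⟨φ, hφ, hφC, hclose⟩ := exists_isTest_eLpNorm_sub_le hΩ hK hKΩ ENNReal.ofNat_ne_top hm hΦ
    hsupp hconv hC hΦC (ENNReal.ofReal_pos.2 hδ)
  have hφL := hφ.memLp 2 (volume.restrict Ω)
  have hdiff := abs_integral_inner_coeFn_le G (hφL.sub (hΦ.restrict Ω)) (le_of_lt hδ)
    ((eLpNorm_mono_measure _ Measure.restrict_le_self).trans hclose)
  simp only [Pi.sub_apply] at hdiff
  rw [integral_inner_coeFn_sub G hφL (hΦ.restrict Ω)] at hdiff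
  linarith [H φ hφ hφC, neg_le_of_abs_le hdiff]

end Field

theorem integrable_frob [IsFiniteMeasure (volume.restrict Ω)] [Fact (1 ≤ r)] (G : L2 Ω (Mat m)) :
    Integrable (fun x => frob r (G x)) (volume.restrict Ω) :=
  (((frobMap m r).comp_memLp' (Lp.memLp G)).integrable one_le_two).norm

theorem setIntegral_frob_le_of_forall_isTest [r.HolderConjugate s] (hΩ : IsOpen Ω)
    (G : L2 Ω (Mat m)) {M : ℝ}
    (H : ∀ φ : Pt → Mat m, IsTest Ω φ → (∀ x, frob s (φ x) ≤ 1) → ∫ x in Ω, ⟪G x, φ x⟫ ≤ M)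
    {K : Set Pt} (hK : IsCompact K) (hKΩ : K ⊆ Ω) : ∫ x in K, frob r (G x) ≤ M := by
  have : Fact (1 ≤ r) := ⟨ENNReal.HolderConjugate.one_le r s⟩
  have : Fact (1 ≤ s) := ⟨ENNReal.HolderConjugate.one_le s r⟩
  refine le_of_eventually_le_add_mul (C := volume.real K) ?_
  filter_upwards [self_mem_nhdsWithin] with δ hδ
  obtain ⟨d, hd, hd1, hdG⟩ := exists_measurable_frob_le_one (m := m) (r := r) (s := s) hδ
  have hm : Measurable fun x => d (G x) := hd.comp (Lp.stronglyMeasurable G).measurable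
  have hle : ∀ x, frob s (K.indicator (fun x => d (G x)) x) ≤ 1 := fun x => by
    by_cases hx : x ∈ K <;> simp [hx, hd1, frob_zero]
  have : IsFiniteMeasure (volume.restrict K) := isFiniteMeasure_restrict.2 hK.measure_ne_top
  have hnorm : ∀ x, ‖d (G x)‖ ≤ √(Fintype.card (Fin m × Fin 2)) * 1 := fun x =>
    (norm_le_mul_frob (p := s) _).trans (mul_le_mul_of_nonneg_left (hd1 _) (Real.sqrt_nonneg _))
  have hdL : MemLp (fun x => d (G x)) 2 (volume.restrict K) :=
    MemLp.of_bound hm.aestronglyMeasurable _ (Eventually.of_forall hnorm)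
  have htest := integral_inner_le_of_forall_isTest hΩ G (convex_frob_le 1)
    (isClosed_le continuous_frob continuous_const) H hK hKΩ
    (hm.indicator hK.measurableSet).stronglyMeasurable
    ((memLp_indicator_iff_restrict hK.measurableSet).2 hdL) Set.support_indicator_subset hle
  have hinner : (fun x => ⟪G x, K.indicator (fun x => d (G x)) x⟫)
      = K.indicator fun x => ⟪G x, d (G x)⟫ := by
    ext x
    by_cases hx : x ∈ K <;> simp [hx]
  rw [hinner, setIntegral_indicator hK.measurableSet, Set.inter_eq_right.2 hKΩ] at htest
  have hGK : MemLp G 2 (volume.restrict K) :=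
    (Lp.memLp G).mono_measure (Measure.restrict_mono hKΩ le_rfl)
  have hGd : Integrable (fun x => ⟪G x, d (G x)⟫) (volume.restrict K) :=
    integrable_inner_of_norm_le (hGK.integrable one_le_two) hm.aestronglyMeasurable hnorm
  calc ∫ x in K, frob r (G x)
      ≤ ∫ x in K, (⟪G x, d (G x)⟫ + δ) :=
        integral_mono (((frobMap m r).comp_memLp' hGK).integrable one_le_two).norm
          (hGd.add (integrable_const δ)) fun x => hdG _
    _ = (∫ x in K, ⟪G x, d (G x)⟫) + δ * volume.real K := by
        rw [integral_add hGd (integrable_const δ), setIntegral_const, smul_eq_mul, mul_comm]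
    _ ≤ M + δ * volume.real K := by grw [htest]

theorem integral_frob_le_of_forall_isTest [r.HolderConjugate s] (hΩ : IsOpen Ω)
    (hbdd : Bornology.IsBounded Ω) (G : L2 Ω (Mat m)) {M : ℝ}
    (H : ∀ φ : Pt → Mat m, IsTest Ω φ → (∀ x, frob s (φ x) ≤ 1) → ∫ x in Ω, ⟪G x, φ x⟫ ≤ M) :
    ∫ x in Ω, frob r (G x) ≤ M := by
  have : Fact (1 ≤ r) := ⟨ENNReal.HolderConjugate.one_le r s⟩
  have : IsFiniteMeasure (volume.restrict Ω) := isFiniteMeasure_restrict.2 hbdd.measure_lt_top.ne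
  obtain ⟨F, hFclosed, hFΩ, hFU, hFmono⟩ := hΩ.exists_iUnion_isClosed
  have hlim := tendsto_setIntegral_of_monotone (μ := volume) (f := fun x => frob r (G x))
    (fun n => (hFclosed n).measurableSet) hFmono (by rw [hFU]; exact integrable_frob G)
  rw [hFU] at hlim
  exact le_of_tendsto' hlim fun n => setIntegral_frob_le_of_forall_isTest hΩ G H
    (Metric.isCompact_of_isClosed_isBounded (hFclosed n) (hbdd.subset (hFΩ n))) (hFΩ n)

end Duality

/-! ## Inward translations of a Lipschitz domain -/

section InwardTranslation

open Filter Topology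
open scoped Manifold

/-- A smooth partition of unity on `Ω` with a direction for each member, such that short
translations in this direction, perturbed by vectors of comparable size, do not lead from `Ω` to
points outside `Ω` in the support of the member. -/
structure InwardPartition (Ω : Set Pt) (ι : Type) [Fintype ι] where
  weight : ι → Pt → ℝ
  dir : ι → Pt
  radius : ℝ
  contDiff_weight : ∀ i, ContDiff ℝ ∞ (weight i)
  weight_nonneg : ∀ i x, 0 ≤ weight i x
  sum_weight_le_one : ∀ x, ∑ i, weight i x ≤ 1
  sum_weight_eq_one : ∀ x ∈ Ω, ∑ i, weight i x = 1
  radius_pos : 0 < radius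
  add_mem : ∀ i, ∀ ε > 0, ε < radius → ∀ y ∈ Ω, ∀ t : Pt, ‖t‖ ≤ ε →
    y + ε • dir i + t ∈ tsupport (weight i) → y + ε • dir i + t ∈ Ω

variable {Ω : Set Pt}

theorem add_mem_epigraph {γ : ℝ → ℝ} {K : NNReal} (hγ : LipschitzWith K γ) {ε : ℝ} {y t : Pt}
    (hy : γ (y 0) < y 1) (ht : ‖t‖ ≤ ε) : γ (y 0 + t 0) < y 1 + ε * (K + 1) + t 1 := by
  have hcoord : ∀ k, |t k| ≤ ε := fun k => (PiLp.norm_apply_le t k).trans ht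
  have hlip : |γ (y 0 + t 0) - γ (y 0)| ≤ K * ε := by
    have h := hγ.dist_le_mul (y 0 + t 0) (y 0)
    rw [Real.dist_eq, Real.dist_eq, add_sub_cancel_left] at h
    exact h.trans (mul_le_mul_of_nonneg_left (hcoord 0) K.2)
  linarith [(abs_le.1 hlip).2, (abs_le.1 (hcoord 1)).1]

theorem exists_inward_direction (hΩ : IsOpen Ω) (hLip : HasLipschitzBoundary Ω) {x : Pt}
    (hx : x ∈ closure Ω) :
    ∃ δ > 0, ∃ a : Pt, ∃ ε₀ > 0, ∀ ε > 0, ε < ε₀ → ∀ y ∈ Ω, ∀ t : Pt, ‖t‖ ≤ ε →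
      y + ε • a + t ∈ Metric.ball x δ → y + ε • a + t ∈ Ω := by
  by_cases hxΩ : x ∈ Ω
  · obtain ⟨δ, hδ, hsub⟩ := Metric.isOpen_iff.1 hΩ x hxΩ
    exact ⟨δ, hδ, 0, 1, one_pos, fun ε _ _ y _ t _ h => hsub h⟩
  obtain ⟨Φ, γ, K, δ, hδ, hγ, hchart⟩ := hLip x ⟨hx, by rwa [hΩ.interior_eq]⟩
  let a : Pt := Φ.symm (EuclideanSpace.single 1 ((K : ℝ) + 1))
  refine ⟨δ / 2, by positivity, a, δ / 2 / (‖a‖ + 1), by positivity, ?_⟩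
  intro ε hε hε₀ y hy t ht hball
  have hsmall : ε * (‖a‖ + 1) < δ / 2 := (lt_div_iff₀ (by positivity)).1 hε₀
  have hshift : dist y (y + ε • a + t) < δ / 2 := by
    rw [add_assoc, dist_self_add_right]
    refine (norm_add_le _ _).trans_lt ?_
    rw [norm_smul, Real.norm_of_nonneg hε.le]
    linarith
  have hyδ : y ∈ Metric.ball x δ :=
    Metric.mem_ball.2 ((dist_triangle _ _ _).trans_lt (by linarith [Metric.mem_ball.1 hball]))
  rw [hchart _ (Metric.ball_subset_ball (by linarith) hball)]
  simpa [a] using add_mem_epigraph hγ ((hchart y hyδ).1 hy) (t := Φ t) (by rwa [Φ.norm_map])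

theorem exists_inwardPartition (hΩ : IsOpen Ω) (hbdd : Bornology.IsBounded Ω)
    (hLip : HasLipschitzBoundary Ω) :
    ∃ (ι : Type) (_ : Fintype ι), Nonempty (InwardPartition Ω ι) := by
  choose δ hδ a ε₀ hε₀ H using fun x : closure Ω => exists_inward_direction hΩ hLip x.2
  obtain ⟨t, ht⟩ := hbdd.isCompact_closure.elim_finite_subcover
    (fun x : closure Ω => Metric.ball (x : Pt) (δ x)) (fun x => Metric.isOpen_ball) fun x hx =>
      Set.mem_iUnion.2 ⟨⟨x, hx⟩, Metric.mem_ball_self (hδ _)⟩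
  rw [← Set.iUnion_subtype (· ∈ t) fun i => Metric.ball ((i : closure Ω) : Pt) (δ i)] at ht
  obtain ⟨f, hf⟩ := SmoothPartitionOfUnity.exists_isSubordinate 𝓘(ℝ, Pt) isClosed_closure
    (fun i : t => Metric.ball ((i : closure Ω) : Pt) (δ i)) (fun i => Metric.isOpen_ball) ht
  obtain ⟨ε, hε, hlt⟩ : ∃ ε > 0, ∀ i : t, ε < ε₀ i := by
    have hsmall : ∀ᶠ ε in 𝓝[>] (0 : ℝ), ∀ i : t, ε < ε₀ i := eventually_all.2 fun i =>
      eventually_nhdsWithin_of_eventually_nhds (eventually_lt_nhds (hε₀ i))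
    exact (eventually_mem_nhdsWithin.and hsmall).exists
  exact ⟨t, inferInstance, ⟨{
    weight := fun i => f i
    dir := fun i => a i
    radius := ε
    contDiff_weight := fun i => (f i).contMDiff.contDiff
    weight_nonneg := fun i x => f.nonneg i x
    sum_weight_le_one := fun x => by
      rw [← finsum_eq_sum_of_fintype]
      exact f.sum_le_one x
    sum_weight_eq_one := fun x hx => by
      rw [← finsum_eq_sum_of_fintype]
      exact f.sum_eq_one (subset_closure hx)
    radius_pos := hε
    add_mem := fun i ε' hε' hε'lt y hy t ht hmem =>
      H i ε' hε' (hε'lt.trans (hlt i)) y hy t ht (hf i hmem) }⟩⟩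

end InwardTranslation

/-! ## Divergence and weak gradients -/

section Divergence

variable {Ω : Set Pt} {m : ℕ} {s : ℝ≥0∞}

/-- The divergence as a linear function of the derivative. -/
def divL (m : ℕ) : (Pt →L[ℝ] Mat m) →L[ℝ] Vec m :=
  LinearMap.toContinuousLinearMap
    { toFun := fun L => WithLp.toLp 2 fun n => ∑ k, L (EuclideanSpace.single k 1) (n, k)
      map_add' := fun L L' => by ext n; simp [Finset.sum_add_distrib]
      map_smul' := fun c L => by ext n; simp [mul_add] }

/-- The divergence of a matrix field, taken in each of the `m` channels. -/
def divergence (φ : Pt → Mat m) (x : Pt) : Vec m :=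
  divL m (fderiv ℝ φ x)

/-- The matrix with the entries `vₙ ∂ₖθ`, as a bilinear function of the derivative of `θ` and of
`v`. For constant `v` it is the gradient of `θ v`. -/
def outer (m : ℕ) : StrongDual ℝ Pt →L[ℝ] Vec m →L[ℝ] Mat m :=
  (LinearMap.mk₂ ℝ
    (fun L v => WithLp.toLp 2 fun j => v j.1 * L (EuclideanSpace.single j.2 1))
    (fun L L' v => by ext j; simp [mul_add]) (fun c L v => by ext j; simp [mul_left_comm])
    (fun L v v' => by ext j; simp [add_mul])
    fun c L v => by ext j; simp [mul_assoc]).toContinuousBilinearMap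

theorem divergence_apply (φ : Pt → Mat m) (x : Pt) (n : Fin m) :
    divergence φ x n = ∑ k, pd k φ x (n, k) := rfl

theorem inner_divL_smulRight (v : Vec m) (L : StrongDual ℝ Pt) (A : Mat m) :
    ⟪v, divL m (L.smulRight A)⟫ = ⟪outer m L v, A⟫ := by
  simp only [inner_eq_sum, Fintype.sum_prod_type]
  refine Finset.sum_congr rfl fun n _ => ?_
  simp [divL, outer, mul_add, mul_assoc]

theorem inner_divergence_smul (v : Vec m) {θ : Pt → ℝ} {ψ : Pt → Mat m} {x : Pt}
    (hθ : DifferentiableAt ℝ θ x) (hψ : DifferentiableAt ℝ ψ x) :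
    ⟪v, divergence (fun y => θ y • ψ y) x⟫
      = ⟪θ x • v, divergence ψ x⟫ + ⟪outer m (fderiv ℝ θ x) v, ψ x⟫ := by
  rw [divergence, fderiv_fun_smul hθ hψ, map_add, map_smul, inner_add_right, inner_smul_right,
    inner_divL_smulRight, real_inner_smul_left, divergence]

theorem divergence_sum {ι : Type*} [Fintype ι] {φ : ι → Pt → Mat m} {x : Pt}
    (hφ : ∀ i, DifferentiableAt ℝ (φ i) x) :
    divergence (fun y => ∑ i, φ i y) x = ∑ i, divergence (φ i) x := by
  rw [divergence, fderiv_fun_sum fun i _ => hφ i, map_sum]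
  rfl

theorem divergence_neg (φ : Pt → Mat m) (x : Pt) :
    divergence (fun y => -φ y) x = -divergence φ x := by
  rw [divergence, fderiv_fun_neg, map_neg, divergence]

theorem continuous_divergence {φ : Pt → Mat m} (hφ : ContDiff ℝ 1 φ) :
    Continuous (divergence φ) :=
  (divL m).continuous.comp (hφ.continuous_fderiv one_ne_zero)

theorem divergence_moll (ρ : ContDiffBump (0 : Pt)) (a : Pt) {φ : Pt → Mat m}
    (hφ : ContDiff ℝ 1 φ) (hc : HasCompactSupport φ) (x : Pt) :
    divergence (moll ρ a φ) x = moll ρ a (divergence φ) x := by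
  rw [divergence, fderiv_moll ρ a hφ hc,
    clm_moll ρ a _ (hφ.continuous_fderiv one_ne_zero).locallyIntegrable]
  rfl

theorem IsTest.contDiff_one {E : Type} [NormedAddCommGroup E] [NormedSpace ℝ E] {φ : Pt → E}
    (hφ : IsTest Ω φ) : ContDiff ℝ 1 φ :=
  hφ.1.of_le (by exact_mod_cast le_top)

theorem IsTest.eq_zero_of_notMem {E : Type} [NormedAddCommGroup E] [NormedSpace ℝ E] {φ : Pt → E}
    (hφ : IsTest Ω φ) {x : Pt} (hx : x ∉ Ω) : φ x = 0 :=
  image_eq_zero_of_notMem_tsupport fun h => hx (hφ.2.2 h)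

theorem IsTest.fderiv {E : Type} [NormedAddCommGroup E] [NormedSpace ℝ E] {φ : Pt → E}
    (hφ : IsTest Ω φ) : IsTest Ω (fderiv ℝ φ) :=
  ⟨hφ.1.fderiv_right (by simp), hφ.2.1.fderiv ℝ, (tsupport_fderiv_subset ℝ).trans hφ.2.2⟩

theorem IsTest.clm_comp {E E' : Type} [NormedAddCommGroup E] [NormedSpace ℝ E]
    [NormedAddCommGroup E'] [NormedSpace ℝ E'] (L : E →L[ℝ] E') {φ : Pt → E}
    (hφ : IsTest Ω φ) : IsTest Ω fun x => L (φ x) :=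
  have hsub : tsupport (fun x => L (φ x)) ⊆ tsupport φ :=
    tsupport_comp_subset (map_zero L) φ
  ⟨L.contDiff.comp hφ.1, hφ.2.1.mono' (subset_closure.trans hsub), hsub.trans hφ.2.2⟩

theorem IsTest.divergence {φ : Pt → Mat m} (hφ : IsTest Ω φ) : IsTest Ω (divergence φ) :=
  hφ.fderiv.clm_comp (divL m)

theorem pd_apply {ι : Type} [Fintype ι] {φ : Pt → EuclideanSpace ℝ ι} {x : Pt}
    (hφ : DifferentiableAt ℝ φ x) (k : Fin 2) (j : ι) :
    pd k φ x j = pd k (fun y => φ y j) x := by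
  have h : HasFDerivAt (fun y => φ y j) _ x :=
    (EuclideanSpace.proj j : EuclideanSpace ℝ ι →L[ℝ] ℝ).hasFDerivAt.comp x hφ.hasFDerivAt
  rw [pd, pd, h.fderiv]
  rfl

theorem ofReal_integral_inner_divergence_le (v : L2 Ω (Vec m)) {φ : Pt → Mat m}
    (hφ : IsTest Ω φ) (hle : ∀ x, frob s (φ x) ≤ 1) :
    ENNReal.ofReal (∫ x in Ω, ⟪v x, divergence φ x⟫) ≤ totalVariation s v := by
  simp only [inner_eq_sum, divergence_apply]
  exact le_iSup₂_of_le φ ⟨hφ, hle⟩ le_rfl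

theorem integral_inner_grad (w : H1 Ω m) {φ : Pt → Mat m} (hφ : IsTest Ω φ) :
    ∫ x in Ω, ⟪grad Ω m w x, φ x⟫ = -∫ x in Ω, ⟪incl Ω m w x, divergence φ x⟫ := by
  have htest : ∀ j, IsTest Ω fun x => φ x j := fun j =>
    hφ.clm_comp (EuclideanSpace.proj j : Mat m →L[ℝ] ℝ)
  have hpd : ∀ x n k, pd k φ x (n, k) = pd k (fun y => φ y (n, k)) x := fun x n k =>
    pd_apply (hφ.1.differentiable (by simp) x) k (n, k)
  simp only [inner_eq_sum, divergence_apply, hpd, Finset.mul_sum, Fintype.sum_prod_type]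
  have hInt : ∀ n k, Integrable (fun x => incl Ω m w x n * pd k (fun y => φ y (n, k)) x)
      (volume.restrict Ω) := fun n k => integrable_coord_mul _ n ((htest _).continuous_pd k)
    ((htest _).hasCompactSupport_pd k)
  have hInt' : ∀ n k, Integrable (fun x => grad Ω m w x (n, k) * φ x (n, k))
      (volume.restrict Ω) := fun n k =>
    integrable_coord_mul _ (n, k) (htest _).1.continuous (htest _).2.1
  rw [integral_finsetSum _ fun n _ => integrable_finsetSum _ fun k _ => hInt' n k,
    integral_finsetSum _ fun n _ => integrable_finsetSum _ fun k _ => hInt n k,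
    ← Finset.sum_neg_distrib]
  refine Finset.sum_congr rfl fun n _ => ?_
  rw [integral_finsetSum _ fun k _ => hInt' n k, integral_finsetSum _ fun k _ => hInt n k,
    ← Finset.sum_neg_distrib]
  exact Finset.sum_congr rfl fun k _ => neg_eq_iff_eq_neg.1 (w.2 _ (htest (n, k)) n k).symm

end Divergence

section SmoothFunctions

variable {Ω : Set Pt} {m : ℕ}

theorem memLp_restrict_of_continuous {E : Type*} [NormedAddCommGroup E]
    (hΩ : IsOpen Ω) (hbdd : Bornology.IsBounded Ω) {θ : Pt → E} (hθ : Continuous θ) (p : ℝ≥0∞) :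
    MemLp θ p (volume.restrict Ω) := by
  have : IsFiniteMeasure (volume.restrict Ω) := isFiniteMeasure_restrict.2 hbdd.measure_lt_top.ne
  obtain ⟨C, hC⟩ := hbdd.isCompact_closure.exists_bound_of_continuousOn hθ.continuousOn
  exact MemLp.of_bound hθ.aestronglyMeasurable C <| (ae_restrict_iff' hΩ.measurableSet).2 <|
    Filter.Eventually.of_forall fun x hx => hC x (subset_closure hx)

theorem integral_mul_pd_eq_neg {W φ : Pt → ℝ} (hW : ContDiff ℝ ∞ W) (hφ : IsTest Ω φ)
    (k : Fin 2) : ∫ x in Ω, W x * pd k φ x = -∫ x in Ω, pd k W x * φ x := by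
  have hWk : Continuous (pd k W) := (hW.continuous_fderiv (by simp)).clm_apply continuous_const
  rw [setIntegral_eq_integral_of_forall_compl_eq_zero fun x hx => by
      rw [pd, hφ.fderiv.eq_zero_of_notMem hx, zero_apply, mul_zero],
    setIntegral_eq_integral_of_forall_compl_eq_zero fun x hx => by
      rw [hφ.eq_zero_of_notMem hx, mul_zero]]
  refine integral_mul_fderiv_eq_neg_fderiv_mul_of_integrable ?_ ?_ ?_
    (fun x _ => hW.differentiable (by simp) x) fun x _ => hφ.1.differentiable (by simp) x
  · exact (hWk.mul hφ.1.continuous).integrable_of_hasCompactSupport hφ.2.1.mul_left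
  · exact (hW.continuous.mul (hφ.continuous_pd k)).integrable_of_hasCompactSupport
      (hφ.hasCompactSupport_pd k).mul_left
  · exact (hW.continuous.mul hφ.1.continuous).integrable_of_hasCompactSupport hφ.2.1.mul_left

theorem exists_H1_of_contDiff (hΩ : IsOpen Ω) (hbdd : Bornology.IsBounded Ω) {W : Pt → Vec m}
    (hW : ContDiff ℝ ∞ W) : ∃ w : H1 Ω m, incl Ω m w =ᵐ[volume.restrict Ω] W := by
  have hWn : ∀ n, ContDiff ℝ ∞ fun x => W x n := fun n =>
    (EuclideanSpace.proj n : Vec m →L[ℝ] ℝ).contDiff.comp hW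
  let DW : Pt → Mat m := fun x => WithLp.toLp 2 fun j => pd j.2 (fun y => W y j.1) x
  have hDW : Continuous DW := (PiLp.continuous_toLp 2 _).comp <| continuous_pi fun j =>
    ((hWn j.1).continuous_fderiv (by simp)).clm_apply continuous_const
  have hWL := memLp_restrict_of_continuous hΩ hbdd hW.continuous 2
  have hDWL := memLp_restrict_of_continuous hΩ hbdd hDW 2
  refine ⟨⟨WithLp.toLp 2 (hWL.toLp W, hDWL.toLp DW), fun φ hφ n k => ?_⟩, hWL.coeFn_toLp⟩
  calc ∫ x in Ω, hWL.toLp W x n * pd k φ x = ∫ x in Ω, W x n * pd k φ x :=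
        integral_congr_ae (by filter_upwards [hWL.coeFn_toLp] with x hx; rw [hx])
    _ = -∫ x in Ω, pd k (fun y => W y n) x * φ x := integral_mul_pd_eq_neg (hWn n) hφ k
    _ = -∫ x in Ω, hDWL.toLp DW x (n, k) * φ x := congrArg Neg.neg <|
        integral_congr_ae (by filter_upwards [hDWL.coeFn_toLp] with x hx; rw [hx])

end SmoothFunctions

/-! ## Smooth approximation in total variation -/

section InwardAverage

open Filter Topology

variable {Ω : Set Pt} {m : ℕ}

section Cutoff

variable {E E' E'' : Type} [NormedAddCommGroup E] [NormedSpace ℝ E] [NormedAddCommGroup E']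
  [NormedSpace ℝ E'] [NormedAddCommGroup E''] [NormedSpace ℝ E''] (B : E' →L[ℝ] E →L[ℝ] E'')

theorem stronglyMeasurable_indicator_clm₂ (hΩ : IsOpen Ω) {θ : Pt → E'} (hθ : Continuous θ)
    (v : L2 Ω E) : StronglyMeasurable (Ω.indicator fun x => B (θ x) (v x)) := by
  have hθm : StronglyMeasurable θ := hθ.stronglyMeasurable
  refine StronglyMeasurable.indicator ?_ hΩ.measurableSet
  exact B.continuous₂.comp_stronglyMeasurable (hθm.prodMk (Lp.stronglyMeasurable v))

theorem memLp_indicator_clm₂ (hΩ : IsOpen Ω) (hbdd : Bornology.IsBounded Ω) {p : ℝ≥0∞}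
    (hp : p ≤ 2) {θ : Pt → E'} (hθ : Continuous θ) (v : L2 Ω E) :
    MemLp (Ω.indicator fun x => B (θ x) (v x)) p := by
  have : IsFiniteMeasure (volume.restrict Ω) := isFiniteMeasure_restrict.2 hbdd.measure_lt_top.ne
  rw [memLp_indicator_iff_restrict hΩ.measurableSet]
  exact (memLp_restrict_of_continuous hΩ hbdd hθ ⊤).of_bilin (q := p) (fun a b => B a b) ‖B‖₊
    ((Lp.memLp v).mono_exponent hp)
    (B.aestronglyMeasurable_comp₂ hθ.aestronglyMeasurable (Lp.aestronglyMeasurable v))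
    (Eventually.of_forall fun x => B.le_opNorm₂ _ _)

theorem contDiff_moll_indicator_clm₂ (hΩ : IsOpen Ω) (hbdd : Bornology.IsBounded Ω)
    (ρ : ContDiffBump (0 : Pt)) (a : Pt) {θ : Pt → E'} (hθ : Continuous θ) (v : L2 Ω E) :
    ContDiff ℝ ∞ (moll ρ a (Ω.indicator fun x => B (θ x) (v x))) :=
  contDiff_moll ρ a
    ((memLp_indicator_clm₂ B hΩ hbdd le_rfl hθ v).locallyIntegrable one_le_two)

theorem exists_eLpNorm_sum_moll_indicator_sub_le [CompleteSpace E''] (hΩ : IsOpen Ω)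
    (hbdd : Bornology.IsBounded Ω) {p : ℝ≥0∞} [Fact (1 ≤ p)] (hp : p ≤ 2) {ι : Type} [Fintype ι]
    (a : ι → Pt) {θ : ι → Pt → E'} (hθ : ∀ i, Continuous (θ i)) (v : L2 Ω E) {δ : ℝ≥0∞}
    (hδ : 0 < δ) :
    ∃ η > 0, ∀ ρ : ContDiffBump (0 : Pt), ρ.rOut < η →
      eLpNorm (fun x => ∑ i, moll ρ (ρ.rOut • a i) (Ω.indicator fun y => B (θ i y) (v y)) x
        - Ω.indicator (fun y => B (∑ i, θ i y) (v y)) x) p ≤ δ := by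
  obtain ⟨η, hη, H⟩ := exists_eLpNorm_sum_moll_sub_le (hp.trans_lt (by simp)).ne a
    (fun i => stronglyMeasurable_indicator_clm₂ B hΩ (hθ i) v)
    (fun i => memLp_indicator_clm₂ B hΩ hbdd hp (hθ i) v) hδ
  refine ⟨η, hη, fun ρ hρ => le_of_eq_of_le ?_ (H ρ hρ)⟩
  congr 1
  ext x
  by_cases hx : x ∈ Ω <;> simp [hx]

end Cutoff

theorem integral_inner_indicator {E : Type*} [NormedAddCommGroup E] [InnerProductSpace ℝ E]
    (hΩ : IsOpen Ω) (f g : Pt → E) :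
    ∫ x, ⟪Ω.indicator f x, g x⟫ = ∫ x in Ω, ⟪f x, g x⟫ := by
  rw [← integral_indicator hΩ.measurableSet]
  congr 1 with x
  by_cases hx : x ∈ Ω <;> simp [hx]

theorem integral_inner_le_of_eLpNorm_one_le {α E : Type*} [MeasurableSpace α] {μ : Measure α}
    [NormedAddCommGroup E] [InnerProductSpace ℝ E] {f g : α → E} (hf : AEStronglyMeasurable f μ)
    {δ C : ℝ} (hδ : 0 ≤ δ) (hfδ : eLpNorm f 1 μ ≤ ENNReal.ofReal δ) (hC : 0 ≤ C)
    (hg : ∀ x, ‖g x‖ ≤ C) : ∫ x, ⟪f x, g x⟫ ∂μ ≤ C * δ := by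
  have hInt : Integrable f μ := memLp_one_iff_integrable.1 ⟨hf, hfδ.trans_lt ENNReal.ofReal_lt_top⟩
  calc ∫ x, ⟪f x, g x⟫ ∂μ ≤ ∫ x, C * ‖f x‖ ∂μ :=
        (Real.le_norm_self _).trans <| norm_integral_le_of_norm_le (hInt.norm.const_mul C) <|
          Eventually.of_forall fun x => (norm_inner_le_norm _ _).trans <| by
            rw [mul_comm]
            gcongr
            exact hg x
    _ = C * (eLpNorm f 1 μ).toReal := by
        rw [integral_const_mul, integral_norm_eq_lintegral_enorm hf,
          eLpNorm_one_eq_lintegral_enorm]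
    _ ≤ C * δ := by
        gcongr
        exact ENNReal.toReal_le_of_le_ofReal hδ hfδ

theorem integral_inner_sum {ι E : Type} [Fintype ι] [NormedAddCommGroup E]
    [InnerProductSpace ℝ E] {F : ι → Pt → E} (hF : ∀ i, Continuous (F i)) {φ : Pt → E}
    (hφ : IsTest Ω φ) : ∫ x, ⟪∑ i, F i x, φ x⟫ = ∑ i, ∫ x, ⟪F i x, φ x⟫ := by
  simp only [sum_inner]
  exact integral_finsetSum _ fun i _ =>
    ((hF i).inner hφ.1.continuous).integrable_of_hasCompactSupport
      (hφ.2.1.mono fun x hx h0 => hx (by simp only [h0, inner_zero_right]))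

theorem setIntegral_inner_outer (hΩ : IsOpen Ω) (hbdd : Bornology.IsBounded Ω)
    (v : L2 Ω (Vec m)) {θ : Pt → ℝ} (hθ : ContDiff ℝ 1 θ) {ψ : Pt → Mat m}
    (hψ : ContDiff ℝ 1 ψ) :
    ∫ x in Ω, ⟪outer m (fderiv ℝ θ x) (v x), ψ x⟫
      = (∫ x in Ω, ⟪v x, divergence (fun y => θ y • ψ y) x⟫)
        - ∫ x in Ω, ⟪v x, θ x • divergence ψ x⟫ := by
  refine Eq.trans ?_ (integral_inner_coeFn_sub v
    (memLp_restrict_of_continuous hΩ hbdd (continuous_divergence (hθ.smul hψ)) 2)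
    (memLp_restrict_of_continuous hΩ hbdd (hθ.continuous.smul (continuous_divergence hψ)) 2))
  congr 1 with x
  change _ = ⟪v x, divergence (fun y => θ y • ψ y) x - θ x • divergence ψ x⟫
  rw [inner_sub_right, inner_divergence_smul _ (hθ.differentiable one_ne_zero x)
    (hψ.differentiable one_ne_zero x), real_inner_smul_left, real_inner_smul_right,
    add_sub_cancel_left]

theorem integral_inner_moll_divergence (hΩ : IsOpen Ω) (hbdd : Bornology.IsBounded Ω)
    (v : L2 Ω (Vec m)) (ρ : ContDiffBump (0 : Pt)) (a : Pt) {θ : Pt → ℝ} (hθ : ContDiff ℝ 1 θ)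
    {φ : Pt → Mat m} (hφ : IsTest Ω φ) :
    ∫ x, ⟪moll ρ a (Ω.indicator fun y => θ y • v y) x, divergence φ x⟫
      = (∫ x in Ω, ⟪v x, divergence (fun y => θ y • moll ρ (-a) φ y) x⟫)
        - ∫ x, ⟪moll ρ a (Ω.indicator fun y => outer m (fderiv ℝ θ y) (v y)) x, φ x⟫ := by
  obtain ⟨C, hC⟩ := hφ.1.continuous.bounded_above_of_compact_support hφ.2.1
  obtain ⟨C', hC'⟩ :=
    hφ.divergence.1.continuous.bounded_above_of_compact_support hφ.divergence.2.1
  have hψ : ContDiff ℝ 1 (moll ρ (-a) φ) :=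
    (contDiff_moll ρ (-a) hφ.1.continuous.locallyIntegrable).of_le (by exact_mod_cast le_top)
  have hF : Integrable (Ω.indicator fun y => θ y • v y) := memLp_one_iff_integrable.1 <|
    memLp_indicator_clm₂ (ContinuousLinearMap.lsmul ℝ ℝ) hΩ hbdd one_le_two hθ.continuous v
  have hF' : Integrable (Ω.indicator fun y => outer m (fderiv ℝ θ y) (v y)) :=
    memLp_one_iff_integrable.1 <| memLp_indicator_clm₂ (outer m) hΩ hbdd one_le_two
      (hθ.continuous_fderiv one_ne_zero) v
  rw [integral_inner_moll ρ a hF hφ.divergence.1.continuous hC',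
    integral_inner_moll ρ a hF' hφ.1.continuous hC, integral_inner_indicator hΩ,
    integral_inner_indicator hΩ, setIntegral_inner_outer hΩ hbdd v hθ hψ, sub_sub_cancel]
  congr 1 with x
  rw [real_inner_smul_left, real_inner_smul_right, divergence_moll ρ _ hφ.contDiff_one hφ.2.1]

namespace InwardPartition

variable {ι : Type} [Fintype ι] (P : InwardPartition Ω ι)

/-- The average of inward translates of the pieces of `v`, smoothed by the bump function `ρ`. -/
def average (ρ : ContDiffBump (0 : Pt)) (v : L2 Ω (Vec m)) (x : Pt) : Vec m :=
  ∑ i, moll ρ (ρ.rOut • P.dir i) (Ω.indicator fun y => P.weight i y • v y) x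

/-- The adjoint of `average`. -/
def pullback (ρ : ContDiffBump (0 : Pt)) (φ : Pt → Mat m) (x : Pt) : Mat m :=
  ∑ i, P.weight i x • moll ρ (-(ρ.rOut • P.dir i)) φ x

/-- The part of the gradient of `average` in which the weights are differentiated. -/
def commutator (ρ : ContDiffBump (0 : Pt)) (v : L2 Ω (Vec m)) (x : Pt) : Mat m :=
  ∑ i, moll ρ (ρ.rOut • P.dir i)
    (Ω.indicator fun y => outer m (fderiv ℝ (P.weight i) y) (v y)) x

variable {P} in
open Pointwise in
theorem isTest_pullback {ρ : ContDiffBump (0 : Pt)} (hρ : ρ.rOut < P.radius) {φ : Pt → Mat m}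
    (hφ : IsTest Ω φ) : IsTest Ω (P.pullback ρ φ) := by
  let K : Set Pt := ⋃ i, tsupport (P.weight i) ∩
    (tsupport φ + Metric.closedBall (ρ.rOut • P.dir i) ρ.rOut)
  have hK : IsCompact K := isCompact_iUnion fun i =>
    (hφ.2.1.isCompact.add (isCompact_closedBall _ _)).inter_left (isClosed_tsupport _)
  have hKΩ : K ⊆ Ω := by
    refine Set.iUnion_subset fun i x hx => ?_
    obtain ⟨hweight, y, hy, t, ht, rfl⟩ := hx
    have hsplit : y + ρ.rOut • P.dir i + (t - ρ.rOut • P.dir i) = y + t := by abel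
    have h := P.add_mem i ρ.rOut ρ.rOut_pos hρ y (hφ.2.2 hy) (t - ρ.rOut • P.dir i)
      (mem_closedBall_iff_norm.1 ht)
    rw [hsplit] at h
    exact h hweight
  have hsupp : tsupport (P.pullback ρ φ) ⊆ K := by
    refine closure_minimal (fun x hx => ?_) hK.isClosed
    obtain ⟨i, -, hi⟩ := Finset.exists_ne_zero_of_sum_ne_zero hx
    obtain ⟨hweight, hmoll⟩ := smul_ne_zero_iff.1 hi
    have hx' := support_moll_subset ρ _ φ hmoll
    rw [neg_neg] at hx'
    exact Set.mem_iUnion.2 ⟨i, subset_tsupport _ hweight,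
      Set.add_subset_add_right (subset_tsupport φ) hx'⟩
  refine ⟨ContDiff.sum fun i _ => (P.contDiff_weight i).smul
    (contDiff_moll ρ _ hφ.1.continuous.locallyIntegrable), ?_, hsupp.trans hKΩ⟩
  exact hK.of_isClosed_subset (isClosed_tsupport _) hsupp

theorem frob_pullback_le {s : ℝ≥0∞} [Fact (1 ≤ s)] (ρ : ContDiffBump (0 : Pt)) {φ : Pt → Mat m}
    (hφ : Continuous φ) (hle : ∀ x, frob s (φ x) ≤ 1) (x : Pt) :
    frob s (P.pullback ρ φ x) ≤ 1 := by
  have hmoll : ∀ i, frob s (moll ρ (-(ρ.rOut • P.dir i)) φ x) ≤ 1 := fun i =>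
    moll_mem_of_forall_mem ρ _ (convex_frob_le 1)
      (isClosed_le continuous_frob continuous_const) hφ.locallyIntegrable hle x
  calc frob s (P.pullback ρ φ x)
      = ‖∑ i, P.weight i x • frobMap m s (moll ρ (-(ρ.rOut • P.dir i)) φ x)‖ := by
        simp only [frob_eq_norm, pullback, map_sum, map_smul]
    _ ≤ ∑ i, P.weight i x * frob s (moll ρ (-(ρ.rOut • P.dir i)) φ x) :=
        norm_sum_le_of_le _ fun i _ => by
          rw [norm_smul, Real.norm_of_nonneg (P.weight_nonneg i x), frob_eq_norm]
    _ ≤ ∑ i, P.weight i x := Finset.sum_le_sum fun i _ =>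
        mul_le_of_le_one_right (P.weight_nonneg i x) (hmoll i)
    _ ≤ 1 := P.sum_weight_le_one x

theorem contDiff_average (hΩ : IsOpen Ω) (hbdd : Bornology.IsBounded Ω)
    (ρ : ContDiffBump (0 : Pt)) (v : L2 Ω (Vec m)) : ContDiff ℝ ∞ (P.average ρ v) :=
  ContDiff.sum fun i _ => contDiff_moll_indicator_clm₂ (ContinuousLinearMap.lsmul ℝ ℝ) hΩ hbdd
    ρ _ (P.contDiff_weight i).continuous v

theorem contDiff_commutator (hΩ : IsOpen Ω) (hbdd : Bornology.IsBounded Ω)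
    (ρ : ContDiffBump (0 : Pt)) (v : L2 Ω (Vec m)) : ContDiff ℝ ∞ (P.commutator ρ v) :=
  ContDiff.sum fun i _ => contDiff_moll_indicator_clm₂ (outer m) hΩ hbdd ρ _
    ((P.contDiff_weight i).continuous_fderiv (by simp)) v

theorem sum_fderiv_weight (hΩ : IsOpen Ω) {x : Pt} (hx : x ∈ Ω) :
    ∑ i, fderiv ℝ (P.weight i) x = 0 := by
  have hconst : (fun y => ∑ i, P.weight i y) =ᶠ[𝓝 x] fun _ => (1 : ℝ) :=
    (hΩ.eventually_mem hx).mono P.sum_weight_eq_one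
  rw [← fderiv_fun_sum fun i _ => (P.contDiff_weight i).differentiable (by simp) x,
    hconst.fderiv_eq, fderiv_const_apply]

theorem exists_eLpNorm_average_sub_le (hΩ : IsOpen Ω) (hbdd : Bornology.IsBounded Ω)
    (v : L2 Ω (Vec m)) {δ : ℝ≥0∞} (hδ : 0 < δ) :
    ∃ η > 0, ∀ ρ : ContDiffBump (0 : Pt), ρ.rOut < η →
      eLpNorm (fun x => P.average ρ v x - v x) 2 (volume.restrict Ω) ≤ δ := by
  obtain ⟨η, hη, H⟩ := exists_eLpNorm_sum_moll_indicator_sub_le (ContinuousLinearMap.lsmul ℝ ℝ)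
    hΩ hbdd le_rfl P.dir (fun i => (P.contDiff_weight i).continuous) v hδ
  refine ⟨η, hη, fun ρ hρ => le_trans (le_of_eq ?_)
    ((eLpNorm_mono_measure _ (Measure.restrict_le_self (s := Ω))).trans (H ρ hρ))⟩
  refine eLpNorm_congr_ae ?_
  filter_upwards [ae_restrict_mem hΩ.measurableSet] with x hx
  simp only [Set.indicator_of_mem hx, P.sum_weight_eq_one x hx, ContinuousLinearMap.lsmul_apply,
    one_smul, average]

theorem exists_eLpNorm_commutator_le (hΩ : IsOpen Ω) (hbdd : Bornology.IsBounded Ω)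
    (v : L2 Ω (Vec m)) {δ : ℝ≥0∞} (hδ : 0 < δ) :
    ∃ η > 0, ∀ ρ : ContDiffBump (0 : Pt), ρ.rOut < η → eLpNorm (P.commutator ρ v) 1 ≤ δ := by
  obtain ⟨η, hη, H⟩ := exists_eLpNorm_sum_moll_indicator_sub_le (outer m) hΩ hbdd one_le_two
    P.dir (fun i => (P.contDiff_weight i).continuous_fderiv (by simp)) v hδ
  refine ⟨η, hη, fun ρ hρ => le_of_eq_of_le ?_ (H ρ hρ)⟩
  -- The limit `∑ᵢ outer ∇ζᵢ v` of the commutators vanishes, since `∑ᵢ ζᵢ = 1` in `Ω`.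
  have hlim : (Ω.indicator fun y => outer m (∑ i, fderiv ℝ (P.weight i) y) (v y)) = 0 :=
    Set.indicator_eq_zero'.2 <| Set.disjoint_left.2 fun x hx hxΩ =>
      hx (by simp only [P.sum_fderiv_weight hΩ hxΩ, map_zero, zero_apply])
  simp only [hlim, Pi.zero_apply, sub_zero]
  rfl

theorem setIntegral_inner_average_divergence (hΩ : IsOpen Ω) (hbdd : Bornology.IsBounded Ω)
    (ρ : ContDiffBump (0 : Pt)) (v : L2 Ω (Vec m)) {φ : Pt → Mat m} (hφ : IsTest Ω φ) :
    ∫ x in Ω, ⟪P.average ρ v x, divergence φ x⟫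
      = (∫ x in Ω, ⟪v x, divergence (P.pullback ρ φ) x⟫)
        - ∫ x, ⟪P.commutator ρ v x, φ x⟫ := by
  have hψ : ∀ i, ContDiff ℝ 1 fun y => P.weight i y • moll ρ (-(ρ.rOut • P.dir i)) φ y :=
    fun i => ((P.contDiff_weight i).smul (contDiff_moll ρ _
      hφ.1.continuous.locallyIntegrable)).of_le (by exact_mod_cast le_top)
  have hdiv : ∫ x in Ω, ⟪v x, divergence (P.pullback ρ φ) x⟫ = ∑ i, ∫ x in Ω, ⟪v x,
      divergence (fun y => P.weight i y • moll ρ (-(ρ.rOut • P.dir i)) φ y) x⟫ := by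
    rw [← integral_finsetSum _ fun i _ => integrable_inner_coeFn v
      (memLp_restrict_of_continuous hΩ hbdd (continuous_divergence (hψ i)) 2)]
    congr 1 with x
    rw [← inner_sum, ← divergence_sum fun i => (hψ i).differentiable one_ne_zero x]
    rfl
  have havg := integral_inner_sum (fun i => (contDiff_moll_indicator_clm₂
    (ContinuousLinearMap.lsmul ℝ ℝ) hΩ hbdd ρ (ρ.rOut • P.dir i)
      (P.contDiff_weight i).continuous v).continuous) hφ.divergence
  have hcomm := integral_inner_sum (fun i => (contDiff_moll_indicator_clm₂ (outer m) hΩ hbdd ρ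
    (ρ.rOut • P.dir i) ((P.contDiff_weight i).continuous_fderiv (by simp)) v).continuous) hφ
  rw [setIntegral_eq_integral_of_forall_compl_eq_zero fun x hx => by
    rw [hφ.divergence.eq_zero_of_notMem hx, inner_zero_right], hdiv]
  refine havg.trans (Eq.trans ?_ (congrArg _ hcomm.symm))
  rw [← Finset.sum_sub_distrib]
  exact Finset.sum_congr rfl fun i _ => integral_inner_moll_divergence hΩ hbdd v ρ _
    ((P.contDiff_weight i).of_le (by exact_mod_cast le_top)) hφ

theorem setIntegral_inner_grad_le {s : ℝ≥0∞} [Fact (1 ≤ s)] (hΩ : IsOpen Ω)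
    (hbdd : Bornology.IsBounded Ω) {ρ : ContDiffBump (0 : Pt)} (hρ : ρ.rOut < P.radius)
    {v : L2 Ω (Vec m)} (hv : totalVariation s v ≠ ⊤) {δ : ℝ} (hδ : 0 ≤ δ)
    (hcomm : eLpNorm (P.commutator ρ v) 1 ≤ ENNReal.ofReal δ) {w : H1 Ω m}
    (hw : incl Ω m w =ᵐ[volume.restrict Ω] P.average ρ v) {φ : Pt → Mat m} (hφ : IsTest Ω φ)
    (hle : ∀ x, frob s (φ x) ≤ 1) :
    ∫ x in Ω, ⟪grad Ω m w x, φ x⟫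
      ≤ (totalVariation s v).toReal + √(Fintype.card (Fin m × Fin 2)) * δ := by
  have hψ : IsTest Ω fun x => -P.pullback ρ φ x :=
    (isTest_pullback hρ hφ).clm_comp (-ContinuousLinearMap.id ℝ (Mat m))
  have hvψ : ∫ x in Ω, ⟪v x, divergence (fun y => -P.pullback ρ φ y) x⟫
      ≤ (totalVariation s v).toReal :=
    (ENNReal.ofReal_le_iff_le_toReal hv).1 <| ofReal_integral_inner_divergence_le v hψ fun x => by
      rw [frob_neg]
      exact P.frob_pullback_le ρ hφ.1.continuous hle x
  simp only [divergence_neg, inner_neg_right, integral_neg] at hvψ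
  have hrest : ∫ x, ⟪P.commutator ρ v x, φ x⟫ ≤ √(Fintype.card (Fin m × Fin 2)) * δ :=
    integral_inner_le_of_eLpNorm_one_le
      (P.contDiff_commutator hΩ hbdd ρ v).continuous.aestronglyMeasurable hδ hcomm
      (Real.sqrt_nonneg _) fun x => (norm_le_mul_frob (p := s) (φ x)).trans <|
        mul_le_of_le_one_right (Real.sqrt_nonneg _) (hle x)
  have havg : ∫ x in Ω, ⟪incl Ω m w x, divergence φ x⟫
      = ∫ x in Ω, ⟪P.average ρ v x, divergence φ x⟫ :=
    integral_congr_ae (hw.mono fun x hx => by simp only [hx])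
  rw [integral_inner_grad w hφ, havg, P.setIntegral_inner_average_divergence hΩ hbdd ρ v hφ]
  linarith

end InwardPartition

theorem exists_H1_approx {r s : ℝ≥0∞} [r.HolderConjugate s] (hΩ : IsOpen Ω)
    (hbdd : Bornology.IsBounded Ω) (hLip : HasLipschitzBoundary Ω) {v : L2 Ω (Vec m)}
    (hv : totalVariation s v ≠ ⊤) {ε : ℝ} (hε : 0 < ε) :
    ∃ w : H1 Ω m, ‖incl Ω m w - v‖ ≤ ε ∧
      ∫ x in Ω, frob r (grad Ω m w x) ≤ (totalVariation s v).toReal + ε := by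
  have : Fact (1 ≤ s) := ⟨ENNReal.HolderConjugate.one_le s r⟩
  obtain ⟨ι, _, ⟨P⟩⟩ := exists_inwardPartition hΩ hbdd hLip
  let C : ℝ := √(Fintype.card (Fin m × Fin 2))
  have : 0 ≤ C := Real.sqrt_nonneg _
  obtain ⟨η₁, hη₁, havg⟩ := P.exists_eLpNorm_average_sub_le hΩ hbdd v (ENNReal.ofReal_pos.2 hε)
  obtain ⟨η₂, hη₂, hcomm⟩ := P.exists_eLpNorm_commutator_le hΩ hbdd v
    (ENNReal.ofReal_pos.2 (show 0 < ε / (C + 1) by positivity))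
  obtain ⟨e, he, hlt⟩ := exists_between (lt_min (lt_min hη₁ hη₂) P.radius_pos)
  simp only [lt_min_iff] at hlt
  obtain ⟨ρ, rfl⟩ := exists_contDiffBump_rOut_eq (0 : Pt) he
  obtain ⟨w, hw⟩ := exists_H1_of_contDiff hΩ hbdd (P.contDiff_average hΩ hbdd ρ v)
  refine ⟨w, ?_, ?_⟩
  · rw [Lp.norm_def]
    refine ENNReal.toReal_le_of_le_ofReal hε.le (le_of_eq_of_le ?_ (havg ρ hlt.1.1))
    refine eLpNorm_congr_ae ?_
    filter_upwards [hw, Lp.coeFn_sub (incl Ω m w) v] with x hx hsub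
    rw [hsub, Pi.sub_apply, hx]
  · refine integral_frob_le_of_forall_isTest (s := s) hΩ hbdd _ fun φ hφ hle => ?_
    have hCε : C * (ε / (C + 1)) ≤ ε := by
      rw [mul_div_assoc', div_le_iff₀ (by positivity), mul_comm]
      gcongr
      exact le_add_of_nonneg_right zero_le_one
    exact (P.setIntegral_inner_grad_le hΩ hbdd hlt.2 hv (by positivity) (hcomm ρ hlt.1.2) hw hφ
      hle).trans (by gcongr)

end InwardAverage

/-! ## Quadratic growth of the energy -/

section Energy

open Filter Topology

variable {Ω : Set Pt} {m : ℕ}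

theorem IsWeakGradient.eq_zero (hΩ : IsOpen Ω) {G : L2 Ω (Mat m)} (hG : IsWeakGradient Ω 0 G) :
    G = 0 := by
  have hcoord : ∀ j, ∀ᵐ x ∂(volume.restrict Ω), G x j = 0 := by
    refine fun j => (ae_restrict_iff' hΩ.measurableSet).2 ?_
    have hloc : LocallyIntegrable (fun x => G x j) (volume.restrict Ω) :=
      ((EuclideanSpace.proj j : Mat m →L[ℝ] ℝ).comp_memLp' (Lp.memLp G)).locallyIntegrable
        one_le_two
    refine hΩ.ae_eq_zero_of_integral_contDiff_smul_eq_zero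
      (locallyIntegrableOn_of_locallyIntegrable_restrict hloc) fun φ hφ hc hs => ?_
    have hleft : ∫ x in Ω, (0 : L2 Ω (Vec m)) x j.1 * pd j.2 φ x = 0 := by
      refine integral_eq_zero_of_ae ?_
      filter_upwards [Lp.coeFn_zero (Vec m) 2 (volume.restrict Ω)] with x hx
      rw [hx]
      simp
    rw [← setIntegral_eq_integral_of_forall_compl_eq_zero (s := Ω) fun x hx => by
      rw [IsTest.eq_zero_of_notMem ⟨hφ, hc, hs⟩ hx, zero_smul]]
    simp only [smul_eq_mul, mul_comm (φ _)]
    exact neg_eq_zero.1 ((hG φ ⟨hφ, hc, hs⟩ j.1 j.2).symm.trans hleft)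
  refine Lp.ext ?_
  filter_upwards [ae_all_iff.2 hcoord, Lp.coeFn_zero (Mat m) 2 (volume.restrict Ω)] with x hx hzero
  rw [hzero]
  ext j
  exact hx j

theorem incl_injective (hΩ : IsOpen Ω) : Function.Injective (incl Ω m) := by
  refine (injective_iff_map_eq_zero _).2 fun w (hw : w.1.fst = 0) => ?_
  have hgrad : w.1.snd = 0 := IsWeakGradient.eq_zero hΩ (hw ▸ w.2)
  exact Subtype.ext (WithLp.ofLp_injective 2 (Prod.ext hw hgrad))

variable {g : L2 Ω ℝ} {α₁ α₂ β lam : ℝ} {r s : ℝ≥0∞} {T : L2 Ω (Vec m) →L[ℝ] L2 Ω ℝ} {S : Reg}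

theorem extEnergy_incl (hΩ : IsOpen Ω) (w : H1 Ω m) :
    extEnergy g α₁ α₂ β lam r s T S (incl Ω m w) = (primalEnergy g α₁ α₂ β lam r T S w : ℝ) := by
  have h : ∃ w' : H1 Ω m, incl Ω m w' = incl Ω m w := ⟨w, rfl⟩
  rw [extEnergy, dif_pos h, incl_injective hΩ h.choose_spec]

theorem sNormSqExt_incl (hΩ : IsOpen Ω) (w : H1 Ω m) :
    sNormSqExt S (incl Ω m w) = ENNReal.ofReal (sNormSq S w) := by
  cases S with
  | id => rfl
  | grad =>
    have h : ∃ w' : H1 Ω m, incl Ω m w' = incl Ω m w := ⟨w, rfl⟩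
    rw [sNormSqExt, dif_pos h, incl_injective hΩ h.choose_spec, sNormSq]

theorem sNormSq_nonneg (w : H1 Ω m) : 0 ≤ sNormSq S w := by
  cases S <;> exact sq_nonneg _

theorem coe_ofReal_of_nonneg {x : ℝ} (hx : 0 ≤ x) : ((ENNReal.ofReal x : ℝ≥0∞) : EReal) = x := by
  rw [EReal.coe_ennreal_ofReal, max_eq_left hx]

theorem bNormSq_incl (hΩ : IsOpen Ω) (hβ : 0 ≤ β) (w : H1 Ω m) :
    bNormSq α₂ β T S (incl Ω m w) = (α₂ * ‖T (incl Ω m w)‖ ^ 2 + β * sNormSq S w : ℝ) := by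
  rw [bNormSq, sNormSqExt_incl hΩ, ← ENNReal.ofReal_mul hβ,
    coe_ofReal_of_nonneg (mul_nonneg hβ (sNormSq_nonneg w)), EReal.coe_add]

theorem bNormSq_id (hβ : 0 ≤ β) (v : L2 Ω (Vec m)) :
    bNormSq α₂ β T .id v = (α₂ * ‖T v‖ ^ 2 + β * ‖v‖ ^ 2 : ℝ) := by
  rw [bNormSq, sNormSqExt, ← ENNReal.ofReal_mul hβ, coe_ofReal_of_nonneg (by positivity),
    EReal.coe_add]

theorem norm_sq_convexCombination {V : Type*} [NormedAddCommGroup V] [InnerProductSpace ℝ V]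
    (a b : V) (t : ℝ) : ‖(1 - t) • a + t • b‖ ^ 2
      = (1 - t) * ‖a‖ ^ 2 + t * ‖b‖ ^ 2 - t * (1 - t) * ‖b - a‖ ^ 2 := by
  simp only [← real_inner_self_eq_norm_sq, inner_add_left, inner_add_right, inner_sub_left,
    inner_sub_right, real_inner_smul_left, real_inner_smul_right, real_inner_comm a b]
  ring

theorem sNormSq_convexCombination (a b : H1 Ω m) (t : ℝ) : sNormSq S ((1 - t) • a + t • b)
    = (1 - t) * sNormSq S a + t * sNormSq S b - t * (1 - t) * sNormSq S (b - a) := by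
  cases S <;> simp only [sNormSq, map_add, map_sub, map_smul, norm_sq_convexCombination]

theorem integral_comp_convexCombination_le {α F : Type*} [MeasurableSpace α] {μ : Measure α}
    [NormedAddCommGroup F] [NormedSpace ℝ F] {p : ℝ≥0∞} {ν : F → ℝ} (hν : ConvexOn ℝ Set.univ ν)
    (hInt : ∀ f : Lp F p μ, Integrable (fun x => ν (f x)) μ) (a b : Lp F p μ) {t : ℝ}
    (ht₀ : 0 ≤ t) (ht₁ : t ≤ 1) : ∫ x, ν (((1 - t) • a + t • b : Lp F p μ) x) ∂μ
      ≤ (1 - t) * (∫ x, ν (a x) ∂μ) + t * ∫ x, ν (b x) ∂μ := by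
  rw [← integral_const_mul, ← integral_const_mul,
    ← integral_add ((hInt a).const_mul _) ((hInt b).const_mul _)]
  refine integral_mono_ae (hInt _) (((hInt a).const_mul _).add ((hInt b).const_mul _)) ?_
  filter_upwards [Lp.coeFn_add ((1 - t) • a) (t • b), Lp.coeFn_smul (1 - t) a,
    Lp.coeFn_smul t b] with x hx ha hb
  rw [hx, Pi.add_apply, ha, hb]
  exact hν.2 (Set.mem_univ _) (Set.mem_univ _) (sub_nonneg.2 ht₁) ht₀ (sub_add_cancel _ _)

section FiniteMeasure

variable [IsFiniteMeasure (volume.restrict Ω)]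

theorem integrable_abs (f : L2 Ω ℝ) : Integrable (fun x => |f x|) (volume.restrict Ω) :=
  ((Lp.memLp f).integrable one_le_two).norm

theorem primalEnergy_convexCombination_le [Fact (1 ≤ r)] (hα₁ : 0 ≤ α₁) (hlam : 0 ≤ lam)
    (a b : H1 Ω m) {t : ℝ} (ht₀ : 0 ≤ t) (ht₁ : t ≤ 1) :
    primalEnergy g α₁ α₂ β lam r T S ((1 - t) • a + t • b)
      ≤ (1 - t) * primalEnergy g α₁ α₂ β lam r T S a + t * primalEnergy g α₁ α₂ β lam r T S b
        - t * (1 - t) * (1 / 2 * (α₂ * ‖T (incl Ω m (b - a))‖ ^ 2 + β * sNormSq S (b - a))) := by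
  have hcomb : T (incl Ω m ((1 - t) • a + t • b)) - g
      = (1 - t) • (T (incl Ω m a) - g) + t • (T (incl Ω m b) - g) := by
    simp only [map_add, map_smul]
    module
  have hdiff : T (incl Ω m (b - a)) = (T (incl Ω m b) - g) - (T (incl Ω m a) - g) := by
    simp only [map_sub, sub_sub_sub_cancel_right]
  have hfid := integral_comp_convexCombination_le (convexOn_univ_norm (E := ℝ)) integrable_abs
    (T (incl Ω m a) - g) (T (incl Ω m b) - g) ht₀ ht₁
  have htv := integral_comp_convexCombination_le (convexOn_frob (p := r)) integrable_frob
    (grad Ω m a) (grad Ω m b) ht₀ ht₁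
  simp only [Real.norm_eq_abs] at hfid
  simp only [primalEnergy, hcomb, hdiff, norm_sq_convexCombination, sNormSq_convexCombination,
    map_add (grad Ω m), map_smul (grad Ω m)]
  linarith [mul_le_mul_of_nonneg_left hfid hα₁, mul_le_mul_of_nonneg_left htv hlam]

theorem IsPrimalSolution.half_sq_add_le [Fact (1 ≤ r)] (hα₁ : 0 ≤ α₁) (hlam : 0 ≤ lam)
    {u : H1 Ω m} (hu : IsPrimalSolution g α₁ α₂ β lam r T S u) (w : H1 Ω m) :
    1 / 2 * (α₂ * ‖T (incl Ω m (w - u))‖ ^ 2 + β * sNormSq S (w - u))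
        + primalEnergy g α₁ α₂ β lam r T S u
      ≤ primalEnergy g α₁ α₂ β lam r T S w := by
  refine le_of_eventually_le_add_mul
    (C := 1 / 2 * (α₂ * ‖T (incl Ω m (w - u))‖ ^ 2 + β * sNormSq S (w - u))) ?_
  filter_upwards [Ioo_mem_nhdsGT one_pos] with t ht
  have hconv := primalEnergy_convexCombination_le (g := g) (α₂ := α₂) (β := β) (r := r) (T := T)
    (S := S) hα₁ hlam u w ht.1.le ht.2.le
  have hmin := hu ((1 - t) • u + t • w)
  refine le_of_mul_le_mul_left ?_ ht.1
  linarith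

theorem continuous_integral_abs : Continuous fun f : L2 Ω ℝ => ∫ x in Ω, |f x| := by
  have hinner : ∀ f : L2 Ω ℝ, ∫ x in Ω, |f x| = ⟪|f|, (memLp_const (1 : ℝ)).toLp⟫ := by
    intro f
    rw [← integral_inner_coeFn_eq_inner_toLp]
    refine integral_congr_ae ?_
    filter_upwards [Lp.coeFn_abs f] with x hx
    simp [hx]
  simp only [hinner]
  exact (continuous_id.sup continuous_neg).inner continuous_const

end FiniteMeasure

theorem IsPrimalSolution.half_sq_add_le_of_totalVariation_ne_top [r.HolderConjugate s]
    (hΩ : IsOpen Ω) (hbdd : Bornology.IsBounded Ω) (hLip : HasLipschitzBoundary Ω) (hα₁ : 0 ≤ α₁)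
    (hlam : 0 ≤ lam) {u : H1 Ω m} (hu : IsPrimalSolution g α₁ α₂ β lam r T .id u)
    {v : L2 Ω (Vec m)} (hv : totalVariation s v ≠ ⊤) :
    1 / 2 * (α₂ * ‖T (v - incl Ω m u)‖ ^ 2 + β * ‖v - incl Ω m u‖ ^ 2)
        + primalEnergy g α₁ α₂ β lam r T .id u
      ≤ α₁ * (∫ x in Ω, |(T v - g : L2 Ω ℝ) x|) + α₂ / 2 * ‖T v - g‖ ^ 2 + β / 2 * ‖v‖ ^ 2
        + lam * (totalVariation s v).toReal := by
  have : IsFiniteMeasure (volume.restrict Ω) :=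
    isFiniteMeasure_restrict.2 hbdd.measure_lt_top.ne
  have : Fact (1 ≤ r) := ⟨ENNReal.HolderConjugate.one_le r s⟩
  let excess : L2 Ω (Vec m) → ℝ := fun z => α₁ * (∫ x in Ω, |(T z - g : L2 Ω ℝ) x|)
    + α₂ / 2 * ‖T z - g‖ ^ 2 + β / 2 * ‖z‖ ^ 2
    - 1 / 2 * (α₂ * ‖T (z - incl Ω m u)‖ ^ 2 + β * ‖z - incl Ω m u‖ ^ 2)
  have hcont : Continuous excess := by
    have := continuous_integral_abs.comp (T.continuous.sub (continuous_const (y := g)))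
    simp only [Function.comp_def] at this
    fun_prop
  choose w hw htv using fun k : ℕ => exists_H1_approx (r := r) hΩ hbdd hLip hv
    (Nat.one_div_pos_of_nat (α := ℝ) (n := k))
  have hw_lim : Tendsto (fun k => incl Ω m (w k)) atTop (𝓝 v) :=
    tendsto_iff_norm_sub_tendsto_zero.2 (squeeze_zero (fun _ => norm_nonneg _) hw
      tendsto_one_div_add_atTop_nhds_zero_nat)
  have hlim : Tendsto (fun k : ℕ => excess (incl Ω m (w k))
      + lam * ((totalVariation s v).toReal + 1 / ((k : ℝ) + 1))) atTop
      (𝓝 (excess v + lam * ((totalVariation s v).toReal + 0))) :=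
    ((hcont.tendsto v).comp hw_lim).add
      ((tendsto_const_nhds.add tendsto_one_div_add_atTop_nhds_zero_nat).const_mul lam)
  have hle : primalEnergy g α₁ α₂ β lam r T .id u
      ≤ excess v + lam * ((totalVariation s v).toReal + 0) := by
    refine ge_of_tendsto' hlim fun k => ?_
    have hgrowth := hu.half_sq_add_le hα₁ hlam (w k)
    rw [primalEnergy.eq_def (w := w k), sNormSq, sNormSq, map_sub] at hgrowth
    simp only [excess]
    linarith [mul_le_mul_of_nonneg_left (htv k) hlam]
  simp only [excess] at hle
  linarith

theorem IsPrimalSolution.half_bNormSq_id_add_le [r.HolderConjugate s]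
    (hΩ : IsOpen Ω) (hbdd : Bornology.IsBounded Ω) (hLip : HasLipschitzBoundary Ω) (hα₁ : 0 ≤ α₁)
    (hβ : 0 ≤ β) (hlam : 0 < lam) {u : H1 Ω m} (hu : IsPrimalSolution g α₁ α₂ β lam r T .id u)
    {v : L2 Ω (Vec m)} (hv : ¬∃ w : H1 Ω m, incl Ω m w = v) :
    ((1 / 2 : ℝ) : EReal) * bNormSq α₂ β T .id (v - incl Ω m u)
        + (primalEnergy g α₁ α₂ β lam r T .id u : ℝ)
      ≤ extEnergy g α₁ α₂ β lam r s T .id v := by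
  rw [extEnergy, dif_neg hv, sNormSqExt]
  by_cases htv : totalVariation s v = ⊤
  · rw [htv, ENNReal.mul_top (ENNReal.ofReal_pos.2 hlam).ne', add_top, EReal.coe_ennreal_top,
      EReal.coe_add_top]
    exact le_top
  · rw [← ENNReal.ofReal_toReal htv, ← ENNReal.ofReal_mul (by positivity),
      ← ENNReal.ofReal_mul hlam.le, ← ENNReal.ofReal_add (by positivity) (by positivity),
      coe_ofReal_of_nonneg (by positivity), bNormSq_id hβ]
    norm_cast
    exact (hu.half_sq_add_le_of_totalVariation_ne_top hΩ hbdd hLip hα₁ hlam.le htv).trans_eq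
      (add_assoc _ _ _)

theorem IsPrimalSolution.half_bNormSq_add_le [r.HolderConjugate s] (hΩ : IsOpen Ω)
    (hbdd : Bornology.IsBounded Ω) (hLip : HasLipschitzBoundary Ω) (hα₁ : 0 ≤ α₁) (hβ : 0 ≤ β)
    (hlam : 0 < lam) {u : H1 Ω m} (hu : IsPrimalSolution g α₁ α₂ β lam r T S u)
    (v : L2 Ω (Vec m)) :
    ((1 / 2 : ℝ) : EReal) * bNormSq α₂ β T S (v - incl Ω m u)
        + (primalEnergy g α₁ α₂ β lam r T S u : ℝ)
      ≤ extEnergy g α₁ α₂ β lam r s T S v := by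
  by_cases hv : ∃ w : H1 Ω m, incl Ω m w = v
  · have : IsFiniteMeasure (volume.restrict Ω) :=
      isFiniteMeasure_restrict.2 hbdd.measure_lt_top.ne
    have : Fact (1 ≤ r) := ⟨ENNReal.HolderConjugate.one_le r s⟩
    obtain ⟨w, rfl⟩ := hv
    rw [← map_sub, bNormSq_incl hΩ hβ, extEnergy_incl hΩ]
    exact_mod_cast hu.half_sq_add_le hα₁ hlam.le w
  rcases hβ.eq_or_lt with rfl | hβ'
  · -- For `β = 0` the energies do not depend on `S`.
    have hid : IsPrimalSolution g α₁ α₂ 0 lam r T .id u := by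
      simpa only [IsPrimalSolution, primalEnergy, zero_div, zero_mul] using hu
    simpa only [bNormSq, primalEnergy, extEnergy, zero_div, ENNReal.ofReal_zero, zero_mul] using
      hid.half_bNormSq_id_add_le hΩ hbdd hLip hα₁ hβ hlam hv
  cases S with
  | id => exact hu.half_bNormSq_id_add_le hΩ hbdd hLip hα₁ hβ hlam hv
  | grad =>
    rw [extEnergy, dif_neg hv, sNormSqExt, dif_neg hv,
      ENNReal.mul_top (ENNReal.ofReal_pos.2 (half_pos hβ')).ne', top_add,
      EReal.coe_ennreal_top, EReal.coe_add_top]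
    exact le_top

end Energy

/-! ## Weak duality -/

section WeakDuality

variable {Ω : Set Pt} {m : ℕ} {g : L2 Ω ℝ} {α₁ α₂ β lam : ℝ} {r s : ℝ≥0∞}
  {T : L2 Ω (Vec m) →L[ℝ] L2 Ω ℝ} {S : Reg}

theorem normalOp_apply {V W : Type} [NormedAddCommGroup V] [InnerProductSpace ℝ V]
    [NormedAddCommGroup W] [InnerProductSpace ℝ W] (A : V →L[ℝ] L2 Ω ℝ) (Sg : V →L[ℝ] W)
    (x y : V) : normalOp α₂ β A Sg x y = α₂ * ⟪A x, A y⟫ + β * ⟪Sg x, Sg y⟫ := rfl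

theorem neg_half_apply_inverse_normalOp_le {V W : Type} [NormedAddCommGroup V]
    [InnerProductSpace ℝ V] [NormedAddCommGroup W] [InnerProductSpace ℝ W] (hα₂ : 0 ≤ α₂)
    (hβ : 0 ≤ β) {A : V →L[ℝ] L2 Ω ℝ} {Sg : V →L[ℝ] W} (hB : (normalOp α₂ β A Sg).IsInvertible)
    (f : StrongDual ℝ V) (z : V) :
    -(1 / 2) * f ((normalOp α₂ β A Sg).inverse f)
      ≤ f z + 1 / 2 * (α₂ * ‖A z‖ ^ 2 + β * ‖Sg z‖ ^ 2) := by
  set w := (normalOp α₂ β A Sg).inverse f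
  have hf : f = normalOp α₂ β A Sg w := (hB.self_apply_inverse f).symm
  have hsq : 0 ≤ α₂ * ‖A (z + w)‖ ^ 2 + β * ‖Sg (z + w)‖ ^ 2 := by positivity
  rw [hf, normalOp_apply, normalOp_apply]
  simp only [← real_inner_self_eq_norm_sq, map_add, inner_add_left, inner_add_right,
    real_inner_comm (A w) (A z), real_inner_comm (Sg w) (Sg z)] at hsq ⊢
  linarith

theorem le_invSq_normalOp {V W : Type} [NormedAddCommGroup V] [InnerProductSpace ℝ V]
    [NormedAddCommGroup W] [InnerProductSpace ℝ W] (hα₂ : 0 ≤ α₂) (hβ : 0 ≤ β)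
    {A : V →L[ℝ] L2 Ω ℝ} {Sg : V →L[ℝ] W} (hB : (normalOp α₂ β A Sg).IsInvertible)
    (j : H1 Ω m →L[ℝ] V) (ℓ : StrongDual ℝ (H1 Ω m)) (u : H1 Ω m) :
    ((-2 * (ℓ u + 1 / 2 * (α₂ * ‖A (j u)‖ ^ 2 + β * ‖Sg (j u)‖ ^ 2)) : ℝ) : EReal)
      ≤ invSq (normalOp α₂ β A Sg) j ℓ := by
  refine le_iInf₂ fun f hf => EReal.coe_le_coe_iff.2 ?_
  have hle := neg_half_apply_inverse_normalOp_le hα₂ hβ hB f (j u)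
  have hfu : f (j u) = ℓ u := DFunLike.congr_fun hf u
  linarith

theorem le_bInvNormSq (hα₂ : 0 ≤ α₂) (hβ : 0 ≤ β) (hB : BInvertible α₂ β T S)
    (ℓ : StrongDual ℝ (H1 Ω m)) (u : H1 Ω m) :
    ((-2 * (ℓ u + 1 / 2 * (α₂ * ‖T (incl Ω m u)‖ ^ 2 + β * sNormSq S u)) : ℝ) : EReal)
      ≤ bInvNormSq α₂ β T S ℓ := by
  rw [bInvNormSq]
  rw [BInvertible] at hB
  split_ifs at hB ⊢ with h
  · have hS : β * sNormSq S u = β * ‖incl Ω m u‖ ^ 2 := by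
      rcases h with rfl | rfl
      · rfl
      · simp only [zero_mul]
    rw [hS]
    exact le_invSq_normalOp hα₂ hβ hB (incl Ω m) ℓ u
  · cases S with
    | id => exact absurd (.inl rfl) h
    | grad => exact le_invSq_normalOp hα₂ hβ hB (ContinuousLinearMap.id ℝ (H1 Ω m)) ℓ u

theorem dualResidual_apply (p₁ : L2 Ω ℝ) (p₂ : L2 Ω (Mat m)) (u : H1 Ω m) :
    dualResidual g α₂ T p₁ p₂ u
      = ⟪p₁, T (incl Ω m u)⟫ + ⟪p₂, grad Ω m u⟫ - α₂ * ⟪g, T (incl Ω m u)⟫ := by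
  change ⟪ContinuousLinearMap.adjoint T p₁, incl Ω m u⟫ + ⟪p₂, grad Ω m u⟫
    - α₂ * ⟪ContinuousLinearMap.adjoint T g, incl Ω m u⟫ = _
  simp only [ContinuousLinearMap.adjoint_inner_left]

variable [IsFiniteMeasure (volume.restrict Ω)]

theorem inner_le_mul_integral_abs {p f : L2 Ω ℝ} (hp : ∀ᵐ x ∂(volume.restrict Ω), |p x| ≤ α₁) :
    ⟪p, f⟫ ≤ α₁ * ∫ x in Ω, |f x| := by
  rw [L2.inner_def, ← integral_const_mul]
  refine integral_mono_ae (L2.integrable_inner (𝕜 := ℝ) p f) ((integrable_abs f).const_mul _) ?_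
  filter_upwards [hp] with x hx
  calc ⟪p x, f x⟫ ≤ |p x| * |f x| := real_inner_le_norm _ _
    _ ≤ α₁ * |f x| := by gcongr

theorem inner_le_mul_integral_frob [r.HolderConjugate s] {p f : L2 Ω (Mat m)}
    (hp : ∀ᵐ x ∂(volume.restrict Ω), frob s (p x) ≤ lam) :
    ⟪p, f⟫ ≤ lam * ∫ x in Ω, frob r (f x) := by
  have : Fact (1 ≤ r) := ⟨ENNReal.HolderConjugate.one_le r s⟩
  rw [L2.inner_def, ← integral_const_mul]
  refine integral_mono_ae (L2.integrable_inner (𝕜 := ℝ) p f) ((integrable_frob f).const_mul _) ?_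
  filter_upwards [hp] with x hx
  calc ⟪p x, f x⟫ = ⟪f x, p x⟫ := real_inner_comm _ _
    _ ≤ frob r (f x) * frob s (p x) := inner_le_frob_mul_frob _ _
    _ ≤ lam * frob r (f x) := by
      rw [mul_comm]
      exact mul_le_mul_of_nonneg_right hx (frob_nonneg _)

-- Weak duality `D(p) ≤ E(u)`, solved for the dual norm in `D(p)`.
theorem le_bInvNormSq_dualResidual [r.HolderConjugate s] (hα₂ : 0 ≤ α₂) (hβ : 0 ≤ β)
    (hB : BInvertible α₂ β T S) {p₁ : L2 Ω ℝ} {p₂ : L2 Ω (Mat m)}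
    (hp₁ : ∀ᵐ x ∂(volume.restrict Ω), |p₁ x| ≤ α₁)
    (hp₂ : ∀ᵐ x ∂(volume.restrict Ω), frob s (p₂ x) ≤ lam) (u : H1 Ω m) :
    ((2 * (α₂ / 2 * ‖g‖ ^ 2 - ⟪g, p₁⟫ - primalEnergy g α₁ α₂ β lam r T S u) : ℝ) : EReal)
      ≤ bInvNormSq α₂ β T S (dualResidual g α₂ T p₁ p₂) := by
  refine (EReal.coe_le_coe_iff.2 ?_).trans (le_bInvNormSq hα₂ hβ hB _ u)
  have hfid := inner_le_mul_integral_abs (f := T (incl Ω m u) - g) hp₁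
  have htv := inner_le_mul_integral_frob (r := r) (f := grad Ω m u) hp₂
  have hsq := norm_sub_sq_real (T (incl Ω m u)) g
  rw [inner_sub_right, real_inner_comm g p₁] at hfid
  rw [real_inner_comm] at hsq
  rw [dualResidual_apply, primalEnergy, hsq]
  linarith

end WeakDuality

/-! ## Piecewise constant interpolation -/

namespace SquareGrid

variable {Ω : Set Pt} {N : ℕ} (G : SquareGrid Ω N)

theorem measurableSet_cell (i : Fin N) : MeasurableSet (G.cell i) :=
  (isOpen_square _ _).measurableSet

theorem volume_real_cell (i : Fin N) : volume.real (G.cell i) = G.side i ^ 2 := by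
  have hcell : G.cell i = (MeasurableEquiv.toLp 2 (Fin 2 → ℝ)).symm ⁻¹'
      Set.univ.pi fun k =>
        Set.Ioo (G.center i k - G.side i / 2) (G.center i k + G.side i / 2) := by
    ext y
    simp only [cell, square, Set.mem_ofPred_eq, Set.mem_preimage, Set.mem_univ_pi,
      ← Real.ball_eq_Ioo, Metric.mem_ball, Real.dist_eq, MeasurableEquiv.toLp_symm_apply]
  rw [Measure.real, hcell, (EuclideanSpace.volume_preserving_symm_measurableEquiv_toLp
    (Fin 2)).measure_preimage_equiv, Real.volume_pi_Ioo_toReal fun k => by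
      linarith [G.side_pos i]]
  rw [Fin.prod_univ_two]
  ring

theorem coeFn_interp {F : Type} [NormedAddCommGroup F] (v : Fin N → F) :
    ∀ᵐ x ∂(volume.restrict Ω), G.interp v x = ∑ i, (G.cell i).indicator (fun _ => v i) x := by
  filter_upwards [Lp.coeFn_finsetSum Finset.univ fun i => indicatorConstLp 2
      (G.measurableSet_cell i) (volume_square_ne_top Ω (G.center i) (G.side i)) (v i),
    ae_all_iff.2 fun i => indicatorConstLp_coeFn (p := 2) (hs := G.measurableSet_cell i)
      (hμs := volume_square_ne_top Ω (G.center i) (G.side i)) (c := v i)] with x hsum hi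
  exact (hsum.trans (Finset.sum_apply _ _ _)).trans (Finset.sum_congr rfl fun i _ => hi i)

theorem sum_indicator_of_mem {F : Type*} [AddCommMonoid F] (v : Fin N → F) {i : Fin N} {x : Pt}
    (hx : x ∈ G.cell i) : ∑ j, (G.cell j).indicator (fun _ => v j) x = v i := by
  rw [Finset.sum_eq_single_of_mem i (Finset.mem_univ i) fun j _ hj => ?_,
    Set.indicator_of_mem hx]
  exact Set.indicator_of_notMem (fun hxj => Set.disjoint_left.1 (G.disjoint j i hj) hxj hx) _

theorem ae_interp {F : Type} [NormedAddCommGroup F] {v : Fin N → F} {P : F → Prop}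
    (hzero : P 0) (hv : ∀ i, P (v i)) : ∀ᵐ x ∂(volume.restrict Ω), P (G.interp v x) := by
  filter_upwards [G.coeFn_interp v] with x hx
  rw [hx]
  by_cases hcell : ∃ i, x ∈ G.cell i
  · obtain ⟨i, hi⟩ := hcell
    rw [G.sum_indicator_of_mem v hi]
    exact hv i
  · push Not at hcell
    rwa [Finset.sum_eq_zero fun i _ => Set.indicator_of_notMem (hcell i) _]

theorem inner_interp (f : L2 Ω ℝ) (q : Fin N → ℝ) :
    ⟪f, G.interp q⟫ = G.inner (G.discretize f) q := by
  rw [interp, inner_sum, SquareGrid.inner]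
  refine Finset.sum_congr rfl fun i _ => ?_
  have hside := G.side_pos i
  rw [real_inner_comm, L2.inner_indicatorConstLp_eq_inner_setIntegral ℝ, discretize,
    Measure.restrict_restrict (isOpen_square _ _).measurableSet,
    Set.inter_eq_left.2 (G.subset i)]
  simp only [RCLike.inner_apply, conj_trivial, cell]
  field_simp

theorem discretize_interp (q : Fin N → ℝ) : G.discretize (G.interp q) = q := by
  ext i
  have hconst : ∫ x in G.cell i, G.interp q x = ∫ _x in G.cell i, q i := by
    refine setIntegral_congr_ae (G.measurableSet_cell i) ?_
    filter_upwards [(ae_restrict_iff' (G.measurableSet_cell i)).1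
      (ae_restrict_of_ae_restrict_of_subset (G.subset i) (G.coeFn_interp q))] with x hx hi
    rw [hx hi, G.sum_indicator_of_mem q hi]
  rw [discretize, hconst, setIntegral_const, volume_real_cell, smul_eq_mul,
    inv_mul_cancel_left₀ (pow_ne_zero 2 (G.side_pos i).ne')]

theorem inner_discretize_self_le (f : L2 Ω ℝ) :
    G.inner (G.discretize f) (G.discretize f) ≤ ‖f‖ ^ 2 := by
  have hcross := G.inner_interp f (G.discretize f)
  have hself := G.inner_interp (G.interp (G.discretize f)) (G.discretize f)
  rw [discretize_interp, real_inner_self_eq_norm_sq] at hself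
  -- The projection `I_h f_h` satisfies `⟪f, I_h f_h⟫ = ‖I_h f_h‖²`.
  linarith [norm_sub_sq_real f (G.interp (G.discretize f)),
    sq_nonneg ‖f - G.interp (G.discretize f)‖]

end SquareGrid

/-! ## Discrete feasibility and consistency -/

section Consistency

variable {Ω : Set Pt} {N m : ℕ} {G : SquareGrid Ω N} {g : L2 Ω ℝ} {α₁ α₂ β lam : ℝ} {r s : ℝ≥0∞}
  {T : L2 Ω (Vec m) →L[ℝ] L2 Ω ℝ} {S : Reg} {Ths : (Fin N → ℝ) →ₗ[ℝ] (Fin N → Vec m)}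
  {gradhs : (Fin N → Mat m) →ₗ[ℝ] (Fin N → Vec m)}
  {Bhi : (Fin N → Vec m) →ₗ[ℝ] (Fin N → Vec m)} {p₁ : Fin N → ℝ} {p₂ : Fin N → Mat m}

theorem feasible_of_isMax_discDual [Fact (1 ≤ s)] (hα₁ : 0 ≤ α₁) (hlam : 0 ≤ lam)
    (hp : ∀ q₁ q₂, discDual G g α₁ α₂ lam s Ths gradhs Bhi q₁ q₂
      ≤ discDual G g α₁ α₂ lam s Ths gradhs Bhi p₁ p₂) :
    (∀ i, |p₁ i| ≤ α₁) ∧ ∀ i, frob s (p₂ i) ≤ lam := by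
  by_contra hinfeasible
  have hzero := hp 0 0
  rw [discDual, discDual, if_neg hinfeasible,
    if_pos ⟨fun i => by simpa using hα₁, fun i => by simpa [frob_zero] using hlam⟩] at hzero
  exact EReal.coe_ne_bot _ (le_bot_iff.1 hzero)

theorem le_dualConsistency [IsFiniteMeasure (volume.restrict Ω)] [r.HolderConjugate s]
    (hα₁ : 0 ≤ α₁) (hα₂ : 0 ≤ α₂) (hβ : 0 ≤ β) (hlam : 0 ≤ lam) (hB : BInvertible α₂ β T S)
    (hp₁ : ∀ i, |p₁ i| ≤ α₁) (hp₂ : ∀ i, frob s (p₂ i) ≤ lam) (u : H1 Ω m) :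
    ((α₂ / 2 * ‖g‖ ^ 2 - G.inner (G.discretize g) p₁ - primalEnergy g α₁ α₂ β lam r T S u
      - 1 / 2 * discResidualSq G g α₂ Ths gradhs Bhi p₁ p₂ : ℝ) : EReal)
      ≤ dualConsistency G g α₂ β T S Ths gradhs Bhi p₁ p₂ := by
  have : Fact (1 ≤ s) := ⟨ENNReal.HolderConjugate.one_le s r⟩
  have hdual := le_bInvNormSq_dualResidual (g := g) (r := r) hα₂ hβ hB
    (G.ae_interp (P := fun y => |y| ≤ α₁) (by simpa using hα₁) hp₁)
    (G.ae_interp (P := fun y => frob s y ≤ lam) (by simpa [frob_zero] using hlam) hp₂) u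
  rw [G.inner_interp] at hdual
  have hhalf : (0 : EReal) ≤ ((1 / 2 : ℝ) : EReal) := EReal.coe_nonneg.2 (by norm_num)
  refine le_trans (le_of_eq ?_) (mul_le_mul_of_nonneg_left (EReal.sub_le_sub hdual
    (le_refl (discResidualSq G g α₂ Ths gradhs Bhi p₁ p₂ : EReal))) hhalf)
  norm_cast
  ring

theorem le_add_sub_add_of_nonneg {x : EReal} {a b c d : ℝ} (h : 0 ≤ a + (b - c) + d) :
    x ≤ a + (x + b - c) + d := by
  induction x with
  | bot => exact bot_le
  | coe x =>
    norm_cast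
    linarith
  | top => simp

end Consistency

end PDGap

end

open PDGap

theorem proposition1_general (Ω : Set Pt) (hΩ : IsOpen Ω) (hbdd : Bornology.IsBounded Ω)
    (hLip : HasLipschitzBoundary Ω) (g : L2 Ω ℝ) {α₁ α₂ : ℝ} (hα₁ : 0 ≤ α₁) (hα₂ : 0 ≤ α₂)
    {m : ℕ} {T : L2 Ω (Vec m) →L[ℝ] L2 Ω ℝ} {S : Reg} {β lam : ℝ} {r s : ℝ≥0∞} (hβ : 0 ≤ β)
    (hlam : 0 < lam) (hrs : r⁻¹ + s⁻¹ = 1) (hB : BInvertible α₂ β T S) {u : H1 Ω m}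
    (hu : IsPrimalSolution g α₁ α₂ β lam r T S u) {N : ℕ} (G : SquareGrid Ω N)
    (Th : (Fin N → Vec m) →ₗ[ℝ] (Fin N → ℝ)) (Ths : (Fin N → ℝ) →ₗ[ℝ] (Fin N → Vec m))
    (gradh : (Fin N → Vec m) →ₗ[ℝ] (Fin N → Mat m))
    (gradhs : (Fin N → Mat m) →ₗ[ℝ] (Fin N → Vec m))
    (Bhi : (Fin N → Vec m) →ₗ[ℝ] (Fin N → Vec m))
    {uh : Fin N → Vec m} {ph₁ : Fin N → ℝ} {ph₂ : Fin N → Mat m}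
    (huh : ∀ vh, discEnergy G g α₁ α₂ β lam r S Th gradh uh
      ≤ discEnergy G g α₁ α₂ β lam r S Th gradh vh)
    (hph : ∀ qh₁ qh₂, discDual G g α₁ α₂ lam s Ths gradhs Bhi qh₁ qh₂
      ≤ discDual G g α₁ α₂ lam s Ths gradhs Bhi ph₁ ph₂)
    (vh : Fin N → Vec m) (qh₁ : Fin N → ℝ) (qh₂ : Fin N → Mat m) :
    ((1 / 2 : ℝ) : EReal) * bNormSq α₂ β T S (G.interp uh - incl Ω m u)
      ≤ gapError G g α₁ α₂ β lam r s S Th Ths gradh gradhs Bhi vh qh₁ qh₂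
        + primalConsistency G g α₁ α₂ β lam r s T S Th gradh uh
        + dualConsistency G g α₂ β T S Ths gradhs Bhi ph₁ ph₂ := by
  have : IsFiniteMeasure (volume.restrict Ω) :=
    isFiniteMeasure_restrict.2 hbdd.measure_lt_top.ne
  have : r.HolderConjugate s := ENNReal.holderConjugate_iff.2 hrs
  have : Fact (1 ≤ s) := ⟨ENNReal.HolderConjugate.one_le s r⟩
  have hfeasible := feasible_of_isMax_discDual hα₁ hlam.le hph
  have hgap := EReal.sub_le_sub (EReal.coe_le_coe_iff.2 (huh vh)) (hph qh₁ qh₂)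
  rw [discDual.eq_def (q₁ := ph₁), if_pos hfeasible, ← EReal.coe_sub] at hgap
  have hgrowth := hu.half_bNormSq_add_le (s := s) hΩ hbdd hLip hα₁ hβ hlam (G.interp uh)
  have hdual := le_dualConsistency (g := g) (r := r) (G := G) (Ths := Ths) (gradhs := gradhs)
    (Bhi := Bhi) hα₁ hα₂ hβ hlam.le hB hfeasible.1 hfeasible.2 u
  refine (le_add_sub_add_of_nonneg ?_).trans
    (add_le_add (add_le_add hgap (EReal.sub_le_sub hgrowth le_rfl)) hdual)
  linarith [mul_le_mul_of_nonneg_left (G.inner_discretize_self_le g) hα₂]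

theorem proposition1 (Ω : Set Pt) (hΩ : IsOpen Ω) (hbdd : Bornology.IsBounded Ω)
    (hLip : HasLipschitzBoundary Ω) (g : L2 Ω ℝ) (α₁ α₂ : ℝ) (hα₁ : 0 ≤ α₁) (hα₂ : 0 ≤ α₂) :
    ∃ c : ℝ, 0 ≤ c ∧
      ∀ (m : ℕ) (T : L2 Ω (Vec m) →L[ℝ] L2 Ω ℝ) (S : Reg) (β lam : ℝ) (r s : ℝ≥0∞),
        0 ≤ β → 0 < lam → r⁻¹ + s⁻¹ = 1 → BInvertible α₂ β T S →
      ∀ u : H1 Ω m, IsPrimalSolution g α₁ α₂ β lam r T S u →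
      ∀ (N : ℕ) (G : SquareGrid Ω N)
        (Th : (Fin N → Vec m) →ₗ[ℝ] (Fin N → ℝ))
        (Ths : (Fin N → ℝ) →ₗ[ℝ] (Fin N → Vec m))
        (gradh : (Fin N → Vec m) →ₗ[ℝ] (Fin N → Mat m))
        (gradhs : (Fin N → Mat m) →ₗ[ℝ] (Fin N → Vec m))
        (Bhi : (Fin N → Vec m) →ₗ[ℝ] (Fin N → Vec m))
        (uh : Fin N → Vec m) (ph₁ : Fin N → ℝ) (ph₂ : Fin N → Mat m),
        (∀ vh, discEnergy G g α₁ α₂ β lam r S Th gradh uh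
          ≤ discEnergy G g α₁ α₂ β lam r S Th gradh vh) →
        (∀ qh₁ qh₂, discDual G g α₁ α₂ lam s Ths gradhs Bhi qh₁ qh₂
          ≤ discDual G g α₁ α₂ lam s Ths gradhs Bhi ph₁ ph₂) →
      ∀ (vh : Fin N → Vec m) (qh₁ : Fin N → ℝ) (qh₂ : Fin N → Mat m),
        ((1 / 2 : ℝ) : EReal) * bNormSq α₂ β T S (G.interp uh - incl Ω m u)
          ≤ gapError G g α₁ α₂ β lam r s S Th Ths gradh gradhs Bhi vh qh₁ qh₂
            + ((c * ‖G.interp (G.discretize g) - g‖ : ℝ) : EReal)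
            + primalConsistency G g α₁ α₂ β lam r s T S Th gradh uh
            + dualConsistency G g α₂ β T S Ths gradhs Bhi ph₁ ph₂ := by
  refine ⟨0, le_rfl, fun m T S β lam r s hβ hlam hrs hB u hu N G Th Ths gradh gradhs Bhi uh ph₁ ph₂
    huh hph vh qh₁ qh₂ => ?_⟩
  simpa using proposition1_general Ω hΩ hbdd hLip g hα₁ hα₂ hβ hlam hrs hB hu G Th Ths gradh gradhs
    Bhi huh hph vh qh₁ qh₂
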